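/- Let $d\in\{2,3\}$, $R>0$ and $0<k_{\min}<k_{\max}$. Write $x=(\tilde x,x_d)\in\mathbb R^{d-1}\times\mathbb R$, $B_R=\{x\in\mathbb R^d:|x|<R\}$ and $\tilde B_R=\{\tilde x\in\mathbb R^{d-1}:|\tilde x|<R\}$. Call a pair of complex-valued functions $f=f(\tilde x,k)$ ($\tilde x\in\mathbb R^{d-1}$, $k>0$) and $g=g(x_d)$ ($x_d\in\mathbb R$) admissible if (a) there are non-empty sets $\tilde D\subset\mathbb R^{d-1}$ and $H\subset\mathbb R$ such that the closure of $\tilde D\times H$ is contained in $B_R$, $\operatorname{supp} g\subset\overline H$, and $\operatorname{supp} f(\cdot,k)\subset\overline{\tilde D}$ for all $k>0$ (essential supports); (b) $f(\cdot,k)\in L^2(\tilde B_R)$ for all $k>0$, and $g\in L^2(-R,R)$; (c) for almost every $\tilde x\in\tilde B_R$ the function $k\mapsto f(\tilde x,k)$ is real-analytic on $(0,\infty)$, and $g$ is not almost everywhere zero on $(-R,R)$. Let $f_1,f_2$ and $g$ be such that $(f_1,g)$ and $(f_2,g)$ are admissible. For $j=1,2$ and every $k>0$ let $u_j(\cdot,k):\mathbb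 R^d\to\mathbb C$ be a radiating solution belonging to $H^2(B_R)$ of $$\Delta u_j(x,k)+k^2u_j(x,k)=f_j(\tilde x,k)\,g(x_d),\qquad x\in\mathbb R^d,$$ that is, $u_j(\cdot,k)$ (taken to be its continuous representative) solves the equation in the sense of distributions and satisfies the Sommerfeld radiation condition $\lim_{r\to\infty}r^{\frac{d-1}{2}}(\partial_ru_j-iku_j)=0$, $r=|x|$, uniformly in all directions $x/|x|$. If $u_1(x,k)=u_2(x,k)$ for all $x\in\partial B_R$ and all $k\in[k_{\min},k_{\max}]$, then $f_1(\cdot,k)=f_2(\cdot,k)$ in $L^2(\tilde B_R)$ for every $k>0$. In other words, for known $g$, the source $f(\cdot,k)$ is uniquely determined for every $k>0$ by the Dirichlet data of $u$ on $\partial B_R$ for $k\in[k_{\min},k_{\max}]$. -/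

import Mathlib

open MeasureTheory Set Filter Metric
open scoped ContDiff Laplacian

noncomputable section

namespace HelmholtzSource

/-- Smooth compactly supported complex-valued test functions on the set `Ω`. -/
structure IsTestFunction {d : ℕ} (Ω : Set (EuclideanSpace ℝ (Fin d)))
    (φ : EuclideanSpace ℝ (Fin d) → ℂ) : Prop where
  contDiff : ContDiff ℝ ∞ φ
  hasCompactSupport : HasCompactSupport φ
  tsupport_subset : tsupport φ ⊆ Ω

/-- `v` is the weak partial derivative `∂u/∂x_i` in `Ω`. -/
def HasWeakPartialDeriv {d : ℕ} (Ω : Set (EuclideanSpace ℝ (Fin d))) (i : Fin d)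
    (u v : EuclideanSpace ℝ (Fin d) → ℂ) : Prop :=
  ∀ φ : EuclideanSpace ℝ (Fin d) → ℂ, IsTestFunction Ω φ →
    ∫ x in Ω, u x * fderiv ℝ φ x (EuclideanSpace.single i 1) = -∫ x in Ω, v x * φ x

/-- `u ∈ H²(Ω)`: `u` and its weak partial derivatives of order one and two are in `L²(Ω)`. -/
def MemH2 {d : ℕ} (Ω : Set (EuclideanSpace ℝ (Fin d)))
    (u : EuclideanSpace ℝ (Fin d) → ℂ) : Prop :=
  MemLp u 2 (volume.restrict Ω) ∧
    ∃ (Du : Fin d → EuclideanSpace ℝ (Fin d) → ℂ)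
      (D2u : Fin d → Fin d → EuclideanSpace ℝ (Fin d) → ℂ),
      (∀ i, MemLp (Du i) 2 (volume.restrict Ω) ∧ HasWeakPartialDeriv Ω i u (Du i)) ∧
      ∀ i j, MemLp (D2u i j) 2 (volume.restrict Ω) ∧ HasWeakPartialDeriv Ω j (Du i) (D2u i j)

/-- `Δu + k²u = F` in all of `ℝ^d`, in the sense of distributions. -/
def SolvesHelmholtz {d : ℕ} (k : ℝ) (F u : EuclideanSpace ℝ (Fin d) → ℂ) : Prop :=
  ∀ φ : EuclideanSpace ℝ (Fin d) → ℂ, IsTestFunction univ φ →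
    ∫ x, u x * (Δ φ x + (k : ℂ) ^ 2 * φ x) = ∫ x, F x * φ x

/-- The Sommerfeld radiation condition `r^{(d-1)/2} (∂_r u - i k u) → 0` as `r = |x| → ∞`,
uniformly in the direction `x / |x|`. Differentiability far out is part of the condition, so that
`∂_r u` is a genuine derivative. -/
def SommerfeldRadiation {d : ℕ} (k : ℝ) (u : EuclideanSpace ℝ (Fin d) → ℂ) : Prop :=
  ∀ ε : ℝ, 0 < ε → ∃ r₀ : ℝ, 0 < r₀ ∧ ∀ x : EuclideanSpace ℝ (Fin d), r₀ ≤ ‖x‖ →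
    DifferentiableAt ℝ u x ∧
      ‖x‖ ^ (((d : ℝ) - 1) / 2) *
        ‖fderiv ℝ u x (‖x‖⁻¹ • x) - Complex.I * (k : ℂ) * u x‖ ≤ ε

/-- `u` is the radiating solution of `Δu + k²u = F` in `ℝ^d`, with `u ∈ H²(B_R)`. As `H²` functions
in dimension two and three are continuous after modification on a null set, `u` is taken to be its
continuous representative; this gives the boundary values on `∂B_R` their pointwise meaning. -/
structure IsRadiatingSolution {d : ℕ} (R k : ℝ) (F u : EuclideanSpace ℝ (Fin d) → ℂ) : Prop where
  continuous : Continuous u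
  memH2 : MemH2 (ball 0 R) u
  helmholtz : SolvesHelmholtz k F u
  radiation : SommerfeldRadiation k u

/-- The first `d - 1 = n` coordinates `x̃` of `x = (x̃, x_d) ∈ ℝ^d`. -/
def tilde {n : ℕ} (x : EuclideanSpace ℝ (Fin (n + 1))) : EuclideanSpace ℝ (Fin n) :=
  WithLp.toLp 2 fun i => x i.castSucc

/-- The source term `x ↦ f(x̃, k) g(x_d)` on `ℝ^d`, `d = n + 1`. -/
def source {n : ℕ} (f : EuclideanSpace ℝ (Fin n) → ℝ → ℂ) (g : ℝ → ℂ) (k : ℝ) :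
    EuclideanSpace ℝ (Fin (n + 1)) → ℂ :=
  fun x => f (tilde x) k * g (x (Fin.last n))

/-- The assumptions on the source functions `f(x̃, k)` and `g(x_d)`; both are functions on the whole
space (extended by zero), and `f(·, k)` matters only for `k > 0`. -/
structure IsAdmissible {n : ℕ} (R : ℝ) (f : EuclideanSpace ℝ (Fin n) → ℝ → ℂ) (g : ℝ → ℂ) :
    Prop where
  /-- The essential supports of `g` and of all `f(·, k)` lie in the closures of nonempty sets `H`
  and `D` for which `D × H` is compactly contained in the open ball `B_R`. -/
  support : ∃ (D : Set (EuclideanSpace ℝ (Fin n))) (H : Set ℝ), D.Nonempty ∧ H.Nonempty ∧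
    (∀ᵐ t : ℝ, t ∉ closure H → g t = 0) ∧
    (∀ k : ℝ, 0 < k → ∀ᵐ y : EuclideanSpace ℝ (Fin n), y ∉ closure D → f y k = 0) ∧
    closure {x : EuclideanSpace ℝ (Fin (n + 1)) | tilde x ∈ D ∧ x (Fin.last n) ∈ H} ⊆ ball 0 R
  memLp_f : ∀ k : ℝ, 0 < k → MemLp (fun y => f y k) 2 (volume.restrict (ball 0 R))
  memLp_g : MemLp g 2 (volume.restrict (Ioo (-R) R))
  /-- For almost every `x̃`, the function `k ↦ f(x̃, k)` is real-analytic on `(0, ∞)`. -/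
  analytic : ∀ᵐ y ∂(volume.restrict (ball (0 : EuclideanSpace ℝ (Fin n)) R)),
    AnalyticOnNhd ℝ (fun k => f y k) (Ioi 0)
  g_ne_zero : ¬ g =ᵐ[volume.restrict (Ioo (-R) R)] 0

end HelmholtzSource

end

/-!
Fix a wave number `k` at which the data agree, and put `w = u₁ - u₂`, `f = f₁ - f₂`. Then `w` is a
radiating solution with source `f(x̃) g(x_d)` that vanishes on `∂B_R`.

*The exterior.* The function `w` is zero outside `B_R`. To avoid any regularity theory beyond
dimension one, `w` is projected on the spheres `|x| = r`: for an isotropic vector `ζ` (`ζ·ζ = 0`) the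
polynomial `(ζ·x)^m` is homogeneous and harmonic, and the moment of `w` against it satisfies, up to a
power of `r`, an equation `y'' = (μ / r² - k²) y` on a half-line (`sphereMoment_weak_ode`; a lemma
of du Bois-Reymond type, `exists_hasDerivAt_of_weak_second_deriv`, makes this classical). Since
`y(R) = 0`, the flux `Im (y' ȳ)` vanishes, so the radiation condition forces `y` and `y'` to decay,
and Gronwall's inequality from infinity gives `y = 0` (`eq_zero_of_radiating_ode`). In dimension two
and three the isotropic powers span a dense subspace of the continuous functions on the sphere
(`isotropicPowers_dense_two`, `isotropicPowers_dense_three`), so all moments vanish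
(`sphereMoment_eq_zero`).

*The source.* Testing the equation with a cut-off plane wave gives `∫ f(x̃) g(x_d) e^{iξ·x} dx = 0`
for all `ξ ∈ ℂ^d` with `ξ·ξ = k²` (`integral_source_mul_exp_eq_zero`). For real `ξ̃` and a possibly
imaginary root `ξ_d` of `k² - |ξ̃|²` this is `f̂(ξ̃) ĝ(ξ_d) = 0`. As `ĝ` is entire and not identically
zero, its zeros only account for countably many spheres in the `ξ̃`-space, and `f̂ = 0` almost
everywhere (`ae_eq_zero_of_orthogonal_plane_waves`).

*All wave numbers.* Hence for almost every `x̃` the functions `f₁(x̃, ·)` and `f₂(x̃, ·)` agree at the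
rational points of `[kmin, kmax]`, and by analyticity on `(0, ∞)`.
-/

namespace HelmholtzSource

/-! ### The Laplacian of radial functions times isotropic powers -/

/-- The Laplacian of a `C²` function, computed by differentiating twice along each coordinate
line. -/
lemma laplacian_eq_sum_of_hasDerivAt {d : ℕ} {f : EuclideanSpace ℝ (Fin d) → ℂ}
    {D : Fin d → EuclideanSpace ℝ (Fin d) → ℂ} {D2 : Fin d → ℂ} {x : EuclideanSpace ℝ (Fin d)}
    (hf : ContDiffAt ℝ 2 f x)
    (h1 : ∀ i, ∀ᶠ y in nhds x,
      HasDerivAt (fun t : ℝ => f (y + t • EuclideanSpace.single i 1)) (D i y) 0)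
    (h2 : ∀ i, HasDerivAt (fun t : ℝ => D i (x + t • EuclideanSpace.single i 1)) (D2 i) 0) :
    Δ f x = ∑ i, D2 i := by
  rw [InnerProductSpace.laplacian_eq_iteratedFDeriv_orthonormalBasis f
    (EuclideanSpace.basisFun (Fin d) ℝ)]
  refine Finset.sum_congr rfl fun i _ => ?_
  rw [iteratedFDeriv_two_apply]
  simp only [EuclideanSpace.basisFun_apply, Matrix.cons_val_zero, Matrix.cons_val_one]
  set e : EuclideanSpace ℝ (Fin d) := EuclideanSpace.single i 1
  have hline : ∀ y : EuclideanSpace ℝ (Fin d), HasDerivAt (fun t : ℝ => y + t • e) e 0 := by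
    intro y
    simpa using ((hasDerivAt_id (0 : ℝ)).smul_const e).const_add y
  have hdiff : ∀ᶠ y in nhds x, DifferentiableAt ℝ f y := by
    filter_upwards [hf.eventually (by simp)] with y hy
    exact hy.differentiableAt (by simp)
  have hD : ∀ᶠ y in nhds x, fderiv ℝ f y e = D i y := by
    filter_upwards [hdiff, h1 i] with y hy hy1
    have hy' : HasFDerivAt f (fderiv ℝ f y) (y + (0 : ℝ) • e) := by
      simpa using hy.hasFDerivAt
    exact (hy'.comp_hasDerivAt (0 : ℝ) (hline y)).unique hy1
  have hfd : DifferentiableAt ℝ (fderiv ℝ f) x :=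
    (hf.fderiv_right (m := 1) (by norm_num)).differentiableAt (by simp)
  have hx' : HasFDerivAt (fderiv ℝ f) (fderiv ℝ (fderiv ℝ f) x) (x + (0 : ℝ) • e) := by
    simpa using hfd.hasFDerivAt
  have h3 : HasDerivAt (fun t : ℝ => fderiv ℝ f (x + t • e) e)
      (fderiv ℝ (fderiv ℝ f) x e e) 0 :=
    ((ContinuousLinearMap.apply ℝ ℂ e).hasFDerivAt).comp_hasDerivAt (0 : ℝ)
      (hx'.comp_hasDerivAt (0 : ℝ) (hline x))
  refine h3.unique ((h2 i).congr_of_eventuallyEq ?_)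
  have hc : Tendsto (fun t : ℝ => x + t • e) (nhds 0) (nhds x) := by
    simpa using (hline x).continuousAt.tendsto
  exact hc.eventually hD

/-- The complex linear form `x ↦ ∑ ζ_i x_i` on `ℝ^d` with complex coefficients `ζ`. -/
noncomputable def linForm {d : ℕ} (ζ : Fin d → ℂ) (x : EuclideanSpace ℝ (Fin d)) : ℂ :=
  ∑ i, ζ i * (x i : ℂ)

lemma contDiff_linForm {d : ℕ} (ζ : Fin d → ℂ) {n : WithTop ℕ∞} : ContDiff ℝ n (linForm ζ) := by
  unfold linForm
  refine ContDiff.sum fun i _ => contDiff_const.mul ?_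
  exact Complex.ofRealCLM.contDiff.comp (EuclideanSpace.proj (𝕜 := ℝ) i).contDiff

lemma linForm_add_smul {d : ℕ} (ζ : Fin d → ℂ) (x : EuclideanSpace ℝ (Fin d)) (t : ℝ)
    (i : Fin d) : linForm ζ (x + t • EuclideanSpace.single i 1) = linForm ζ x + t * ζ i := by
  simp [linForm, mul_add, Finset.sum_add_distrib, mul_comm, apply_ite (Complex.ofReal)]

lemma linForm_smul {d : ℕ} (ζ : Fin d → ℂ) (x : EuclideanSpace ℝ (Fin d)) (t : ℝ) :
    linForm ζ (t • x) = t * linForm ζ x := by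
  simp only [linForm, Finset.mul_sum, PiLp.smul_apply, smul_eq_mul, Complex.ofReal_mul]
  exact Finset.sum_congr rfl fun i _ => by ring

lemma hasDerivAt_linForm_line {d : ℕ} (ζ : Fin d → ℂ) (x : EuclideanSpace ℝ (Fin d))
    (i : Fin d) :
    HasDerivAt (fun t : ℝ => linForm ζ (x + t • EuclideanSpace.single i 1)) (ζ i) 0 := by
  simp only [linForm_add_smul]
  simpa using ((hasDerivAt_id (0 : ℝ)).ofReal_comp.mul_const (ζ i)).const_add (linForm ζ x)

lemma laplacian_exp_linForm {d : ℕ} (ξ : Fin d → ℂ) (x : EuclideanSpace ℝ (Fin d)) :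
    Δ (fun x => Complex.exp (Complex.I * linForm ξ x)) x =
      -(∑ i, ξ i ^ 2) * Complex.exp (Complex.I * linForm ξ x) := by
  have key : ∀ (i : Fin d) (y : EuclideanSpace ℝ (Fin d)),
      HasDerivAt (fun t : ℝ => Complex.exp (Complex.I * linForm ξ
        (y + t • EuclideanSpace.single i 1)))
        (Complex.I * ξ i * Complex.exp (Complex.I * linForm ξ y)) 0 := by
    intro i y
    have := ((hasDerivAt_linForm_line ξ y i).const_mul Complex.I).cexp
    simpa [mul_comm] using this
  rw [laplacian_eq_sum_of_hasDerivAt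
    (D := fun i y => Complex.I * ξ i * Complex.exp (Complex.I * linForm ξ y))
    (D2 := fun i => Complex.I * ξ i * (Complex.I * ξ i * Complex.exp (Complex.I * linForm ξ x)))
    ?_ (fun i => Eventually.of_forall (key i)) (fun i => (key i x).const_mul _)]
  · rw [neg_mul, Finset.sum_mul, ← Finset.sum_neg_distrib]
    refine Finset.sum_congr rfl fun i _ => ?_
    linear_combination (ξ i ^ 2 * Complex.exp (Complex.I * linForm ξ x)) * Complex.I_sq
  · exact (contDiff_const.mul (contDiff_linForm ξ)).cexp.contDiffAt

lemma hasDerivAt_norm_line {d : ℕ} {x : EuclideanSpace ℝ (Fin d)} (hx : x ≠ 0) (i : Fin d) :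
    HasDerivAt (fun t : ℝ => ‖x + t • EuclideanSpace.single i (1 : ℝ)‖) (x i / ‖x‖) 0 := by
  have hsq : HasDerivAt (fun t : ℝ => ‖x‖ ^ 2 + 2 * t * x i + t ^ 2) (2 * x i) 0 := by
    have := ((((hasDerivAt_id (0 : ℝ)).const_mul 2).mul_const (x i)).const_add (‖x‖ ^ 2)).fun_add
      ((hasDerivAt_id (0 : ℝ)).fun_pow 2)
    simpa using this
  have heq : (fun t : ℝ => ‖x + t • EuclideanSpace.single i (1 : ℝ)‖) =
      fun t : ℝ => √(‖x‖ ^ 2 + 2 * t * x i + t ^ 2) := by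
    funext t
    rw [eq_comm, Real.sqrt_eq_iff_eq_sq ?_ (norm_nonneg _), norm_add_sq_real]
    · simp [inner_smul_right, norm_smul, EuclideanSpace.inner_single_right]; ring
    · have h : |x i| ≤ ‖x‖ := PiLp.norm_apply_le x i
      have : x i ^ 2 ≤ ‖x‖ ^ 2 := sq_le_sq' (by linarith [neg_abs_le (x i)]) (by
        linarith [le_abs_self (x i)])
      nlinarith [sq_nonneg (x i + t)]
  rw [heq]
  have hx' : ‖x‖ ≠ 0 := norm_ne_zero_iff.2 hx
  have := hsq.sqrt (by simpa using hx)
  simp only [mul_zero, zero_mul, add_zero, ne_eq, OfNat.ofNat_ne_zero, not_false_eq_true,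
    zero_pow, Real.sqrt_sq (norm_nonneg x)] at this
  convert this using 1
  field_simp

/-- The Laplacian of `φ(|x|) (ζ·x)^m` away from the origin when `ζ·ζ = 0`: as `(ζ·x)^m` is a
harmonic homogeneous polynomial, only the radial factor is changed. -/
lemma laplacian_radial_mul_isotropic {d : ℕ} {ζ : Fin d → ℂ} (hζ : ∑ i, ζ i ^ 2 = 0) (m : ℕ)
    {φ φ' φ'' : ℝ → ℂ} (hφ : ContDiff ℝ 2 φ) (hφ' : ∀ r, HasDerivAt φ (φ' r) r)
    (hφ'' : ∀ r, HasDerivAt φ' (φ'' r) r) {x : EuclideanSpace ℝ (Fin d)} (hx : x ≠ 0) :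
    Δ (fun x => φ ‖x‖ * linForm ζ x ^ m) x =
      (φ'' ‖x‖ + (d - 1 + 2 * m) / ‖x‖ * φ' ‖x‖) * linForm ζ x ^ m := by
  have hφline : ∀ {ψ ψ' : ℝ → ℂ}, (∀ r, HasDerivAt ψ (ψ' r) r) → ∀ (i : Fin d)
      {y : EuclideanSpace ℝ (Fin d)}, y ≠ 0 → HasDerivAt
        (fun t : ℝ => ψ ‖y + t • EuclideanSpace.single i (1 : ℝ)‖) ((y i / ‖y‖ : ℝ) * ψ' ‖y‖) 0 := by
    intro ψ ψ' h i y hy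
    have h1 : HasDerivAt ψ (ψ' ‖y‖) ‖y + (0 : ℝ) • EuclideanSpace.single i (1 : ℝ)‖ := by
      simpa using h ‖y‖
    exact (h1.scomp (0 : ℝ) (hasDerivAt_norm_line hy i)).congr_deriv (by simp)
  have hpow : ∀ (n : ℕ) (i : Fin d) (y : EuclideanSpace ℝ (Fin d)), HasDerivAt
      (fun t : ℝ => linForm ζ (y + t • EuclideanSpace.single i (1 : ℝ)) ^ n)
        (n * linForm ζ y ^ (n - 1) * ζ i) 0 := by
    intro n i y
    simpa using (hasDerivAt_linForm_line ζ y i).fun_pow n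
  have hxi : ∀ (i : Fin d), HasDerivAt
      (fun t : ℝ => ((x + t • EuclideanSpace.single i (1 : ℝ)) i : ℂ)) 1 0 := by
    intro i
    have : HasDerivAt (fun t : ℝ => ((x i + t : ℝ) : ℂ)) 1 0 := by
      simpa using ((hasDerivAt_id (0 : ℝ)).const_add (x i)).ofReal_comp
    simpa using this
  have hx0 : (‖x‖ : ℂ) ≠ 0 := by simpa using hx
  rw [laplacian_eq_sum_of_hasDerivAt
    (D := fun i y => ((y i : ℂ) / ‖y‖) * φ' ‖y‖ * linForm ζ y ^ m +
      φ ‖y‖ * (m * linForm ζ y ^ (m - 1) * ζ i))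
    (D2 := fun i => (1 / ‖x‖ - (x i : ℂ) ^ 2 / ‖x‖ ^ 3) * φ' ‖x‖ * linForm ζ x ^ m +
      (x i : ℂ) ^ 2 / ‖x‖ ^ 2 * φ'' ‖x‖ * linForm ζ x ^ m +
      2 * ((x i : ℂ) * ζ i) * (m * linForm ζ x ^ (m - 1) / ‖x‖ * φ' ‖x‖) +
      ζ i ^ 2 * (φ ‖x‖ * (m * ((m - 1 : ℕ) * linForm ζ x ^ (m - 1 - 1)))))]
  · simp only [Finset.sum_add_distrib, ← Finset.sum_mul, ← Finset.mul_sum, hζ,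
      Finset.sum_sub_distrib, ← Finset.sum_div]
    have hn : ∑ i, (x i : ℂ) ^ 2 = (‖x‖ : ℂ) ^ 2 := by
      rw [← Complex.ofReal_pow, EuclideanSpace.real_norm_sq_eq]; simp
    have hl : ∑ i, (x i : ℂ) * ζ i = linForm ζ x := by
      simp [linForm, mul_comm]
    have hm : (m : ℂ) * linForm ζ x ^ m = m * linForm ζ x ^ (m - 1) * linForm ζ x := by
      rcases m with _ | m
      · simp
      · simp [pow_succ]; ring
    rw [hn, hl]
    simp only [Finset.sum_const, Finset.card_univ, Fintype.card_fin, nsmul_eq_mul]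
    field_simp
    linear_combination (2 * φ' ‖x‖) * hm.symm
  · exact (hφ.contDiffAt.comp x (contDiffAt_norm ℝ hx)).mul ((contDiff_linForm ζ).pow m).contDiffAt
  · intro i
    filter_upwards [isOpen_ne.mem_nhds hx] with y hy
    refine ((hφline hφ' i hy).mul (hpow m i y)).congr_deriv ?_
    simp
  · intro i
    have hq : HasDerivAt (fun t : ℝ => ((x + t • EuclideanSpace.single i (1 : ℝ)) i : ℂ) /
        (‖x + t • EuclideanSpace.single i (1 : ℝ)‖ : ℂ)) (1 / ‖x‖ - (x i : ℂ) ^ 2 / ‖x‖ ^ 3) 0 := by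
      refine ((hxi i).div (hasDerivAt_norm_line hx i).ofReal_comp (by simpa using hx)).congr_deriv ?_
      simp
      field_simp
    refine (((hq.mul (hφline hφ'' i hx)).mul (hpow m i x)).add ((hφline hφ' i hx).mul
      (((hpow (m - 1) i x).const_mul (m : ℂ)).mul_const (ζ i)))).congr_deriv ?_
    simp
    field_simp
    ring

/-! ### Second order equations on a half-line -/

/-- `φ` is a smooth function on the line whose support is a compact subset of `(ρ, ∞)`. -/
def IsRayTest (ρ : ℝ) (φ : ℝ → ℂ) : Prop :=
  ContDiff ℝ ∞ φ ∧ ∃ a b : ℝ, ρ < a ∧ ∀ x, x ∉ Icc a b → φ x = 0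

namespace IsRayTest

variable {ρ : ℝ} {φ ψ : ℝ → ℂ}

lemma hasCompactSupport (hφ : IsRayTest ρ φ) : HasCompactSupport φ := by
  obtain ⟨-, a, b, -, h⟩ := hφ
  exact HasCompactSupport.intro isCompact_Icc h

lemma integrable_mul {Y : ℝ → ℂ} (hY : Continuous Y) (hφ : IsRayTest ρ φ) :
    Integrable (fun x => Y x * φ x) :=
  (hY.mul hφ.1.continuous).integrable_of_hasCompactSupport hφ.hasCompactSupport.mul_left

lemma integrable (hφ : IsRayTest ρ φ) : Integrable φ :=
  hφ.1.continuous.integrable_of_hasCompactSupport hφ.hasCompactSupport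

lemma sub_const_mul (hφ : IsRayTest ρ φ) (hψ : IsRayTest ρ ψ) (c : ℂ) :
    IsRayTest ρ (fun x => φ x - c * ψ x) := by
  obtain ⟨h1, a, b, ha, h⟩ := hφ
  obtain ⟨h1', a', b', ha', h'⟩ := hψ
  refine ⟨h1.sub (contDiff_const.mul h1'), min a a', max b b', lt_min ha ha', fun x hx => ?_⟩
  beta_reduce
  rw [h x, h' x]
  · simp
  · exact fun hx' => hx ⟨(min_le_right _ _).trans hx'.1, hx'.2.trans (le_max_right _ _)⟩
  · exact fun hx' => hx ⟨(min_le_left _ _).trans hx'.1, hx'.2.trans (le_max_left _ _)⟩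

lemma hasDerivAt (hφ : IsRayTest ρ φ) (x : ℝ) : HasDerivAt φ (deriv φ x) x :=
  (hφ.1.differentiable (by simp) x).hasDerivAt

lemma deriv (hφ : IsRayTest ρ φ) : IsRayTest ρ (deriv φ) := by
  obtain ⟨h1, a, b, ha, h⟩ := hφ
  refine ⟨(contDiff_infty_iff_deriv.1 h1).2, a, b, ha, fun x hx => ?_⟩
  have : φ =ᶠ[nhds x] fun _ => 0 := by
    filter_upwards [isClosed_Icc.isOpen_compl.mem_nhds hx] with y hy using h y hy
  rw [this.deriv_eq, deriv_const]

lemma integral_deriv_mul (hφ : IsRayTest ρ φ) {u u' : ℝ → ℂ}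
    (hu : ∀ x, HasDerivAt u (u' x) x) (hu' : Continuous u') :
    ∫ x, u x * _root_.deriv φ x = -∫ x, u' x * φ x :=
  integral_mul_deriv_eq_deriv_mul_of_integrable (fun x _ => hu x) (fun x _ => hφ.hasDerivAt x)
    (integrable_mul (continuous_iff_continuousAt.2 fun x => (hu x).continuousAt) hφ.deriv)
    (integrable_mul hu' hφ)
    (integrable_mul (continuous_iff_continuousAt.2 fun x => (hu x).continuousAt) hφ)

/-- A test function with mean zero is the derivative of a test function. -/
lemma exists_deriv_eq (hφ : IsRayTest ρ φ) (h0 : ∫ x, φ x = 0) :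
    ∃ χ, IsRayTest ρ χ ∧ _root_.deriv χ = φ := by
  obtain ⟨h1, a, b, ha, h⟩ := id hφ
  have hd : ∀ x, HasDerivAt (fun x => ∫ t in a..x, φ t) (φ x) x := fun x =>
    (h1.continuous.integral_hasStrictDerivAt a x).hasDerivAt
  have hderiv : _root_.deriv (fun x => ∫ t in a..x, φ t) = φ := funext fun x => (hd x).deriv
  refine ⟨fun x => ∫ t in a..x, φ t, ⟨?_, a, b, ha, fun x hx => ?_⟩, hderiv⟩
  · exact contDiff_infty_iff_deriv.2 ⟨fun x => (hd x).differentiableAt, by rwa [hderiv]⟩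
  · beta_reduce
    simp only [mem_Icc, not_and_or, not_le] at hx
    rcases hx with hx | hx
    · rw [intervalIntegral.integral_symm, intervalIntegral.integral_of_le hx.le, neg_eq_zero,
        ← integral_Ico_eq_integral_Ioc]
      exact setIntegral_eq_zero_of_forall_eq_zero fun t ht => h t fun ht' => ht'.1.not_gt ht.2
    · rcases le_or_gt a x with hax | hax
      · rw [intervalIntegral.integral_eq_integral_of_support_subset, h0]
        intro t ht
        have htI : t ∈ Icc a b := by
          by_contra hc
          exact ht (h t hc)
        refine ⟨lt_of_le_of_ne htI.1 ?_, htI.2.trans hx.le⟩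
        rintro rfl
        -- At the left end point `φ` vanishes by continuity.
        refine ht (tendsto_nhds_unique (h1.continuous.continuousAt.mono_left nhdsWithin_le_nhds :
          Tendsto φ (nhdsWithin a (Iio a)) (nhds (φ a))) ?_)
        refine tendsto_const_nhds.congr' ?_
        filter_upwards [self_mem_nhdsWithin] with s hs
        exact (h s fun hs' => hs'.1.not_gt hs).symm
      · rw [intervalIntegral.integral_symm, intervalIntegral.integral_of_le hax.le, neg_eq_zero]
        exact setIntegral_eq_zero_of_forall_eq_zero fun t ht => h t fun ht' =>
          (hx.trans ht.1).not_ge ht'.2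

lemma exists_integral_eq_one (ρ : ℝ) : ∃ η, IsRayTest ρ η ∧ ∫ x, η x = 1 := by
  let f : ContDiffBump (ρ + 2) := ⟨1 / 2, 1, by norm_num, by norm_num⟩
  refine ⟨fun x => (f.normed volume x : ℂ), ⟨Complex.ofRealCLM.contDiff.comp f.contDiff_normed,
    ρ + 1, ρ + 3, by linarith, fun x hx => ?_⟩, ?_⟩
  · have : f.normed volume x = 0 := by
      rw [← Function.notMem_support, f.support_normed_eq, Real.ball_eq_Ioo]
      exact fun h => hx ⟨by have := h.1; simp [f] at this; linarith,
        by have := h.2; simp [f] at this; linarith⟩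
    simp [this]
  · beta_reduce
    rw [integral_complex_ofReal, f.integral_normed]; simp

end IsRayTest

/-- The lemma of du Bois-Reymond on a half-line. -/
lemma exists_eq_const_of_integral_mul_eq_zero {ρ : ℝ} {Y : ℝ → ℂ} (hY : Continuous Y)
    (h : ∀ φ, IsRayTest ρ φ → ∫ x, φ x = 0 → ∫ x, Y x * φ x = 0) :
    ∃ c, ∀ x, ρ < x → Y x = c := by
  obtain ⟨η, hη, hη1⟩ := IsRayTest.exists_integral_eq_one ρ
  refine ⟨∫ x, Y x * η x, ?_⟩
  set c := ∫ x, Y x * η x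
  have key : ∀ φ, IsRayTest ρ φ → ∫ x, (Y x - c) * φ x = 0 := by
    intro φ hφ
    have h1 := h _ (hφ.sub_const_mul hη (∫ x, φ x)) (by
      rw [integral_sub hφ.integrable (hη.integrable.const_mul _), integral_const_mul, hη1]; simp)
    have h2 : ∫ x, Y x * φ x = (∫ x, φ x) * c := by
      have : (fun x => Y x * (φ x - (∫ x, φ x) * η x)) =
          fun x => Y x * φ x - (∫ x, φ x) * (Y x * η x) := by
        funext x; ring
      rw [this, integral_sub (hφ.integrable_mul hY) ((hη.integrable_mul hY).const_mul _),
        integral_const_mul] at h1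
      linear_combination h1
    simp only [sub_mul]
    rw [integral_sub (hφ.integrable_mul hY) (hφ.integrable.const_mul _), integral_const_mul, h2]
    ring
  have hae := isOpen_Ioi.ae_eq_zero_of_integral_contDiff_smul_eq_zero (μ := volume) (U := Ioi ρ)
    (f := fun x => Y x - c) ((hY.sub continuous_const).locallyIntegrable.locallyIntegrableOn _)
    (fun g hg hgc hgs => by
      have hg' : IsRayTest ρ (fun x => (g x : ℂ)) := by
        refine ⟨Complex.ofRealCLM.contDiff.comp hg, ?_⟩
        rcases (tsupport g).eq_empty_or_nonempty with he | hne
        · exact ⟨ρ + 1, ρ, by linarith, fun x _ => by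
            simp [image_eq_zero_of_notMem_tsupport (he ▸ notMem_empty x : x ∉ tsupport g)]⟩
        · have hcomp : IsCompact (tsupport g) := hgc
          obtain ⟨a, ha⟩ := hcomp.exists_isLeast hne
          obtain ⟨b, hb⟩ := hcomp.exists_isGreatest hne
          refine ⟨a, b, hgs ha.1, fun x hx => ?_⟩
          beta_reduce
          rw [image_eq_zero_of_notMem_tsupport fun hx' => hx ⟨ha.2 hx', hb.2 hx'⟩]
          simp
      simpa [mul_comm] using key _ hg')
  have hae' : (fun x => Y x - c) =ᵐ[volume.restrict (Ioi ρ)] fun _ => 0 := by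
    filter_upwards [ae_restrict_of_ae hae, ae_restrict_mem measurableSet_Ioi] with x hx hx'
      using hx hx'
  intro x hx
  exact sub_eq_zero.1 (Measure.eqOn_open_of_ae_eq hae' isOpen_Ioi
    (hY.sub continuous_const).continuousOn continuousOn_const hx)

/-- A continuous function whose second weak derivative on `(ρ, ∞)` is continuous is twice
differentiable there. -/
lemma exists_hasDerivAt_of_weak_second_deriv {ρ : ℝ} {y h : ℝ → ℂ} (hy : Continuous y)
    (hh : Continuous h)
    (hw : ∀ χ, IsRayTest ρ χ → ∫ x, y x * deriv (deriv χ) x = ∫ x, h x * χ x) :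
    ∃ y' : ℝ → ℂ, ∀ x, ρ < x → HasDerivAt y (y' x) x ∧ HasDerivAt y' (h x) x := by
  set H : ℝ → ℂ := fun x => ∫ t in (0 : ℝ)..x, h t
  have hH : ∀ x, HasDerivAt H (h x) x := fun x => (hh.integral_hasStrictDerivAt 0 x).hasDerivAt
  have hHc : Continuous H := continuous_iff_continuousAt.2 fun x => (hH x).continuousAt
  set G : ℝ → ℂ := fun x => ∫ t in (0 : ℝ)..x, H t
  have hG : ∀ x, HasDerivAt G (H x) x := fun x => (hHc.integral_hasStrictDerivAt 0 x).hasDerivAt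
  have hGc : Continuous G := continuous_iff_continuousAt.2 fun x => (hG x).continuousAt
  have hYc : Continuous (fun x => y x - G x) := hy.sub hGc
  have hY : ∀ χ, IsRayTest ρ χ → ∫ x, (y x - G x) * deriv (deriv χ) x = 0 := by
    intro χ hχ
    simp only [sub_mul]
    rw [integral_sub (hχ.deriv.deriv.integrable_mul hy) (hχ.deriv.deriv.integrable_mul hGc),
      hw χ hχ, hχ.deriv.integral_deriv_mul hG hHc, hχ.integral_deriv_mul hH hh]
    ring
  obtain ⟨η, hη, hη1⟩ := IsRayTest.exists_integral_eq_one ρ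
  set c := ∫ x, (y x - G x) * deriv η x
  have hlin : Continuous (fun x : ℝ => c * (x : ℂ)) := by fun_prop
  obtain ⟨c0, hc0⟩ := exists_eq_const_of_integral_mul_eq_zero (ρ := ρ)
    (Y := fun x => y x - G x + c * x) (hYc.add hlin) (by
      intro ψ hψ hψ0
      obtain ⟨φ, hφ, rfl⟩ := hψ.exists_deriv_eq hψ0
      obtain ⟨χ, hχ, hχφ⟩ := (hφ.sub_const_mul hη (∫ x, φ x)).exists_deriv_eq (by
        rw [integral_sub hφ.integrable (hη.integrable.const_mul _), integral_const_mul, hη1]; simp)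
      have h1 := hY χ hχ
      have hd : ∀ x, deriv (deriv χ) x = deriv φ x - (∫ x, φ x) * deriv η x := by
        intro x
        rw [hχφ]
        exact ((hφ.hasDerivAt x).sub ((hη.hasDerivAt x).const_mul _)).deriv
      have h2 : (fun x => (y x - G x) * deriv (deriv χ) x) = fun x =>
          (y x - G x) * deriv φ x - (∫ x, φ x) * ((y x - G x) * deriv η x) := by
        funext x; rw [hd]; ring
      rw [h2, integral_sub (hφ.deriv.integrable_mul hYc)
        ((hη.deriv.integrable_mul hYc).const_mul _), integral_const_mul] at h1
      have h3 : ∫ x : ℝ, c * (x : ℂ) * deriv φ x = -∫ x : ℝ, c * φ x :=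
        hφ.integral_deriv_mul (fun x => by
          simpa using (hasDerivAt_id x).ofReal_comp.const_mul c) continuous_const
      simp only [add_mul]
      rw [integral_add (hφ.deriv.integrable_mul hYc) (hφ.deriv.integrable_mul hlin), h3,
        integral_const_mul]
      linear_combination h1)
  -- `y - G` is affine on `(ρ, ∞)`, with slope `-c`.
  refine ⟨fun x => H x - c, fun x hx => ⟨?_, (hH x).sub_const c⟩⟩
  have h1 : HasDerivAt (fun x : ℝ => G x + c0 - c * x) (H x - c) x := by
    simpa using ((hG x).add_const c0).fun_sub ((hasDerivAt_id x).ofReal_comp.const_mul c)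
  refine h1.congr_of_eventuallyEq ?_
  filter_upwards [isOpen_Ioi.mem_nhds hx] with t ht
  linear_combination hc0 t ht

/-- The one-dimensional form of Rellich's lemma. A solution of `y'' = (μ / r² - k²) y` on
`(ρ, ∞)` that vanishes at one point has zero flux `Im (y' ȳ)`; together with the radiation
condition this makes `y` and `y'` decay, and then Gronwall's inequality from infinity gives
`y = 0`. -/
lemma eq_zero_of_radiating_ode {ρ R k μ c : ℝ} (hρ : 0 ≤ ρ) (hR : ρ < R) (hk : 0 < k)
    {y y' : ℝ → ℂ} (hy : ∀ r, ρ < r → HasDerivAt y (y' r) r)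
    (hy' : ∀ r, ρ < r → HasDerivAt y' ((μ / r ^ 2 - k ^ 2 : ℝ) * y r) r) (hyR : y R = 0)
    (hrad : Tendsto (fun r : ℝ => y' r - (Complex.I * k + (c / r : ℝ)) * y r) atTop (nhds 0)) :
    ∀ r, ρ < r → y r = 0 := by
  -- The flux is conserved, hence zero.
  have hflux : ∀ r, ρ < r → (y' r * (starRingEnd ℂ) (y r)).im = 0 := by
    have hd : ∀ r, ρ < r → HasDerivAt (fun r => y' r * (starRingEnd ℂ) (y r) -
        y r * (starRingEnd ℂ) (y' r)) 0 r := by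
      intro r hr
      have h1 := (hy r hr).star
      have h2 := (hy' r hr).star
      refine (((hy' r hr).mul h1).sub ((hy r hr).mul h2)).congr_deriv ?_
      simp
      ring
    intro r hr
    have hz := isOpen_Ioi.is_const_of_deriv_eq_zero (s := Ioi ρ)
      (convex_Ioi ρ).isPreconnected (fun r hr => (hd r hr).differentiableAt.differentiableWithinAt)
      (fun r hr => (hd r hr).deriv) (mem_Ioi.2 hr) (mem_Ioi.2 hR)
    simp only [hyR, map_zero, mul_zero, zero_mul, sub_zero] at hz
    have := congrArg Complex.im hz
    simp at this ⊢
    linarith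
  have hbound : ∀ r, ρ < r →
      ‖y r‖ ≤ ‖y' r - (Complex.I * k + (c / r : ℝ)) * y r‖ / k := by
    intro r hr
    set δ := y' r - (Complex.I * k + (c / r : ℝ)) * y r with hδ
    have h1 : (y' r * (starRingEnd ℂ) (y r)).im = k * ‖y r‖ ^ 2 +
        (δ * (starRingEnd ℂ) (y r)).im := by
      have h3 : y' r * (starRingEnd ℂ) (y r) = Complex.I * (k * ‖y r‖ ^ 2 : ℝ) +
          (c / r * ‖y r‖ ^ 2 : ℝ) + δ * (starRingEnd ℂ) (y r) := by
        have h4 : y r * (starRingEnd ℂ) (y r) = (‖y r‖ : ℂ) ^ 2 := Complex.mul_conj' _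
        rw [hδ]; push_cast
        linear_combination (Complex.I * k + c / r) * h4
      rw [h3]; simp [-Complex.ofReal_mul, -Complex.ofReal_pow, -Complex.ofReal_div]
    rw [hflux r hr] at h1
    have h2 : |(δ * (starRingEnd ℂ) (y r)).im| ≤ ‖δ‖ * ‖y r‖ := by
      refine (Complex.abs_im_le_norm _).trans ?_
      simp
    rw [le_div_iff₀ hk]
    rcases (norm_nonneg (y r)).eq_or_lt with h0 | h0
    · rw [← h0]; simp
    · have := neg_abs_le (δ * (starRingEnd ℂ) (y r)).im
      nlinarith
  have hy0 : Tendsto y atTop (nhds 0) := by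
    refine squeeze_zero_norm' (a := fun r => ‖y' r - (Complex.I * k + (c / r : ℝ)) * y r‖ / k) ?_ ?_
    · filter_upwards [eventually_gt_atTop ρ] with r hr using hbound r hr
    · simpa using hrad.norm.div_const k
  have hy'0 : Tendsto y' atTop (nhds 0) := by
    have h1 : Tendsto (fun r : ℝ => Complex.I * k + (c / r : ℝ)) atTop
        (nhds (Complex.I * k + (0 : ℝ))) :=
      tendsto_const_nhds.add ((Complex.continuous_ofReal.tendsto 0).comp
        (tendsto_const_nhds.div_atTop tendsto_id))
    simpa using hrad.add (h1.mul hy0)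
  -- Gronwall's inequality: `E = |y'|² + k²|y|²` satisfies `|E'| ≤ (C / r²) E`, so `E e^{-C/r}` is
  -- monotone; it tends to zero at infinity.
  set C : ℝ := |μ| / k with hC
  set M : ℝ → ℝ := fun r => (‖y' r‖ ^ 2 + k ^ 2 * ‖y r‖ ^ 2) * Real.exp (-(C / r)) with hM
  have hMd : ∀ r, ρ < r → ∃ m, 0 ≤ m ∧ HasDerivAt M m r := by
    intro r hr
    have hr0 : 0 < r := hρ.trans_lt hr
    have h1 : HasDerivAt (fun r => Real.exp (-(C / r))) (Real.exp (-(C / r)) * (C / r ^ 2)) r := by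
      have := ((hasDerivAt_inv hr0.ne').const_mul C).neg.exp
      simpa [div_eq_mul_inv] using this
    refine ⟨_, ?_, ((hy' r hr).norm_sq.add ((hy r hr).norm_sq.const_mul (k ^ 2))).mul h1⟩
    rw [Complex.inner, Complex.inner]
    have h2 : |(y r * (starRingEnd ℂ) (y' r)).re| ≤ ‖y r‖ * ‖y' r‖ := by
      refine (Complex.abs_re_le_norm _).trans ?_
      simp
    have h3 : 2 * ((starRingEnd ℂ) (y' r) * ((μ / r ^ 2 - k ^ 2 : ℝ) * y r)).re +
        k ^ 2 * (2 * ((starRingEnd ℂ) (y r) * y' r).re) =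
        2 * (μ / r ^ 2) * (y r * (starRingEnd ℂ) (y' r)).re := by
      simp only [Complex.mul_re, Complex.mul_im, Complex.ofReal_re, Complex.ofReal_im,
        Complex.conj_re, Complex.conj_im]
      ring
    have h4 : 0 ≤ 2 * (μ / r ^ 2) * (y r * (starRingEnd ℂ) (y' r)).re +
        (‖y' r‖ ^ 2 + k ^ 2 * ‖y r‖ ^ 2) * (C / r ^ 2) := by
      have h5 : 0 ≤ 2 * μ * (y r * (starRingEnd ℂ) (y' r)).re +
          (‖y' r‖ ^ 2 + k ^ 2 * ‖y r‖ ^ 2) * C := by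
        have h6 : |2 * μ * (y r * (starRingEnd ℂ) (y' r)).re| ≤
            2 * |μ| * (‖y r‖ * ‖y' r‖) := by
          rw [abs_mul, abs_mul, abs_two]
          gcongr
        have h7 : 2 * |μ| * (‖y r‖ * ‖y' r‖) ≤ (‖y' r‖ ^ 2 + k ^ 2 * ‖y r‖ ^ 2) * C := by
          rw [hC, ← mul_div_assoc, le_div_iff₀ hk]
          nlinarith [mul_nonneg (abs_nonneg μ) (sq_nonneg (‖y' r‖ - k * ‖y r‖))]
        linarith [neg_abs_le (2 * μ * (y r * (starRingEnd ℂ) (y' r)).re)]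
      have : 2 * (μ / r ^ 2) * (y r * (starRingEnd ℂ) (y' r)).re +
          (‖y' r‖ ^ 2 + k ^ 2 * ‖y r‖ ^ 2) * (C / r ^ 2) =
          (2 * μ * (y r * (starRingEnd ℂ) (y' r)).re +
          (‖y' r‖ ^ 2 + k ^ 2 * ‖y r‖ ^ 2) * C) / r ^ 2 := by
        field_simp
      rw [this]; positivity
    simp only [Pi.add_apply]
    have h8 := mul_nonneg (Real.exp_pos (-(C / r))).le h4
    rw [← h3] at h8
    simp only [mul_comm ((starRingEnd ℂ) _)] at h8
    linarith
  have hmono : MonotoneOn M (Ioi ρ) := by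
    refine monotoneOn_of_deriv_nonneg (convex_Ioi ρ)
      (fun r hr => ?_) (fun r hr => ?_) (fun r hr => ?_)
    · obtain ⟨m, -, hm⟩ := hMd r hr
      exact hm.continuousAt.continuousWithinAt
    · rw [interior_Ioi] at hr
      obtain ⟨m, -, hm⟩ := hMd r hr
      exact hm.differentiableAt.differentiableWithinAt
    · rw [interior_Ioi] at hr
      obtain ⟨m, h0, hm⟩ := hMd r hr
      rwa [hm.deriv]
  have hM0 : Tendsto M atTop (nhds 0) := by
    have h1 : Tendsto (fun r : ℝ => Real.exp (-(C / r))) atTop (nhds (Real.exp (-0))) :=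
      (Real.continuous_exp.tendsto _).comp (tendsto_const_nhds.div_atTop tendsto_id).neg
    simpa using ((hy'0.norm.pow 2).add ((hy0.norm.pow 2).const_mul (k ^ 2))).mul h1
  intro r hr
  have hle : M r ≤ 0 := by
    refine ge_of_tendsto hM0 ?_
    filter_upwards [eventually_ge_atTop r] with s hs
    exact hmono hr (hr.trans_le hs) hs
  have hE : ‖y' r‖ ^ 2 + k ^ 2 * ‖y r‖ ^ 2 ≤ 0 := by
    by_contra hc
    push Not at hc
    exact hle.not_gt (mul_pos hc (Real.exp_pos _))
  have : ‖y r‖ ^ 2 = 0 := by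
    have h1 : 0 ≤ ‖y r‖ ^ 2 := sq_nonneg _
    nlinarith [sq_nonneg ‖y' r‖, pow_pos hk 2]
  simpa using this

/-! ### Density of isotropic powers on the sphere -/

/-- The restriction of the linear form `x ↦ ∑ ζ_i x_i` to the unit sphere. -/
noncomputable def sphereForm {d : ℕ} (ζ : Fin d → ℂ) :
    C(sphere (0 : EuclideanSpace ℝ (Fin d)) 1, ℂ) :=
  ⟨fun θ => linForm ζ θ, (contDiff_linForm ζ (n := 0)).continuous.comp continuous_subtype_val⟩

@[simp] lemma sphereForm_apply {d : ℕ} (ζ : Fin d → ℂ)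
    (θ : sphere (0 : EuclideanSpace ℝ (Fin d)) 1) : sphereForm ζ θ = linForm ζ θ := rfl

/-- The set of the functions `θ ↦ (ζ·θ)^m` on the unit sphere with `ζ·ζ = 0`. -/
def isotropicPowers (d : ℕ) : Set C(sphere (0 : EuclideanSpace ℝ (Fin d)) 1, ℂ) :=
  {p | ∃ (ζ : Fin d → ℂ) (m : ℕ), ∑ i, ζ i ^ 2 = 0 ∧ p = sphereForm ζ ^ m}

lemma linForm_single {d : ℕ} (i : Fin d) (x : EuclideanSpace ℝ (Fin d)) :
    linForm (Pi.single i 1) x = x i := by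
  simp [linForm, Pi.single_apply]

/-- By the Stone–Weierstrass theorem, a closed subspace of `C(S, ℂ)` that contains `1` and is stable
under multiplication by the coordinates is everything. It suffices to check stability on
generators. -/
lemma span_topologicalClosure_eq_top {d : ℕ}
    {G : Set C(sphere (0 : EuclideanSpace ℝ (Fin d)) 1, ℂ)} (h1 : 1 ∈ G)
    (hG : ∀ i, ∀ g ∈ G, sphereForm (Pi.single i 1) * g ∈ (Submodule.span ℂ G).topologicalClosure) :
    (Submodule.span ℂ G).topologicalClosure = ⊤ := by
  set A := (Submodule.span ℂ G).topologicalClosure with hA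
  have hAc : IsClosed (A : Set C(sphere (0 : EuclideanSpace ℝ (Fin d)) 1, ℂ)) :=
    Submodule.isClosed_topologicalClosure _
  have hcoord : ∀ i, ∀ g ∈ A, sphereForm (Pi.single i 1) * g ∈ A := by
    intro i
    have hle : A ≤ A.comap (LinearMap.mulLeft ℂ (sphereForm (Pi.single i 1))) := by
      refine Submodule.topologicalClosure_minimal _ (Submodule.span_le.2 fun g hg => hG i g hg) ?_
      exact hAc.preimage (continuous_const.mul continuous_id)
    exact fun g hg => hle hg
  set s : Set C(sphere (0 : EuclideanSpace ℝ (Fin d)) 1, ℂ) :=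
    range fun i => sphereForm (Pi.single i 1)
  have hstar : ∀ i : Fin d, star (sphereForm (Pi.single i (1 : ℂ))) =
      sphereForm (Pi.single i 1) := by
    intro i
    ext θ
    simp [linForm_single]
  have hmul : ∀ a ∈ StarAlgebra.adjoin ℂ s, ∀ g ∈ A, a * g ∈ A := by
    intro a ha
    change a ∈ Algebra.adjoin ℂ (s ∪ star s) at ha
    induction ha using Algebra.adjoin_induction with
    | mem x hx =>
      rcases hx with ⟨i, rfl⟩ | ⟨i, hi⟩
      · exact hcoord i
      · rw [← star_star x, ← hi, hstar]
        exact hcoord i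
    | algebraMap c =>
      intro g hg
      rw [← Algebra.smul_def]
      exact A.smul_mem c hg
    | add x y _ _ hx hy =>
      intro g hg
      rw [add_mul]
      exact A.add_mem (hx g hg) (hy g hg)
    | mul x y _ _ hx hy =>
      intro g hg
      rw [mul_assoc]
      exact hx _ (hy g hg)
  have h1A : (1 : C(sphere (0 : EuclideanSpace ℝ (Fin d)) 1, ℂ)) ∈ A :=
    Submodule.le_topologicalClosure _ (Submodule.subset_span h1)
  have htop := ContinuousMap.starSubalgebra_topologicalClosure_eq_top_of_separatesPoints
    (StarAlgebra.adjoin ℂ s) (by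
      intro x y hxy
      have : ∃ i, (x : EuclideanSpace ℝ (Fin d)) i ≠ (y : EuclideanSpace ℝ (Fin d)) i := by
        by_contra hc
        push Not at hc
        exact hxy (Subtype.ext (PiLp.ext hc))
      obtain ⟨i, hi⟩ := this
      refine ⟨_, ⟨sphereForm (Pi.single i 1), StarAlgebra.subset_adjoin ℂ s ⟨i, rfl⟩, rfl⟩, ?_⟩
      simpa [linForm_single] using hi)
  rw [eq_top_iff]
  intro f _
  have hf : f ∈ closure (StarAlgebra.adjoin ℂ s : Set C(sphere _ 1, ℂ)) := by
    rw [← StarSubalgebra.topologicalClosure_coe, htop]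
    trivial
  refine closure_minimal (fun a ha => ?_) hAc hf
  simpa using hmul a ha 1 h1A

lemma mem_of_hasDerivAt {E : Type*} [NormedAddCommGroup E] [NormedSpace ℂ E] {A : Submodule ℂ E}
    (hA : IsClosed (A : Set E)) {f : ℂ → E} {f' : E} {x : ℂ} (hf : HasDerivAt f f' x)
    (h : ∀ t, f t ∈ A) : f' ∈ A := by
  refine hA.mem_of_tendsto (hasDerivAt_iff_tendsto_slope.1 hf) (Eventually.of_forall fun t => ?_)
  simp only [slope_def_module]
  exact A.smul_mem _ (A.sub_mem (h t) (h x))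

/-- The isotropic vector `(a² - b², i(a² + b²), 2ab)` with spinor coordinates `(a, b)`. -/
noncomputable def spinorVec (a b : ℂ) : Fin 3 → ℂ :=
  ![a ^ 2 - b ^ 2, Complex.I * (a ^ 2 + b ^ 2), 2 * a * b]

lemma sum_spinorVec_sq (a b : ℂ) : ∑ i, spinorVec a b i ^ 2 = 0 := by
  simp [Fin.sum_univ_three, spinorVec]
  linear_combination (a ^ 2 + b ^ 2) ^ 2 * Complex.I_sq

lemma sphere_sum_sq {d : ℕ} (θ : sphere (0 : EuclideanSpace ℝ (Fin d)) 1) :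
    ∑ i, ((θ : EuclideanSpace ℝ (Fin d)) i : ℂ) ^ 2 = 1 := by
  have h1 : ‖(θ : EuclideanSpace ℝ (Fin d))‖ ^ 2 = 1 := by simp
  rw [EuclideanSpace.real_norm_sq_eq] at h1
  exact_mod_cast h1

/-- Multiplication of an isotropic power by an isotropic linear form on `S²`. The form is moved
along the curve with spinor coordinates `(a + tc, b + td)`; the second derivative of its powers
at `t = 0` is computed with the help of `B² - q_{ab} q_{cd} = (ad - bc)²` on the sphere, where
`B` is the polarization of `q`. -/
lemma spinor_mul_pow_mem {A : Submodule ℂ C(sphere (0 : EuclideanSpace ℝ (Fin 3)) 1, ℂ)}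
    (hA : IsClosed (A : Set C(sphere (0 : EuclideanSpace ℝ (Fin 3)) 1, ℂ)))
    (h : ∀ a b m, sphereForm (spinorVec a b) ^ m ∈ A) (a b c e : ℂ) (m : ℕ) :
    sphereForm (spinorVec c e) * sphereForm (spinorVec a b) ^ m ∈ A := by
  set q := sphereForm (spinorVec a b)
  set p := sphereForm (spinorVec c e)
  set B : C(sphere (0 : EuclideanSpace ℝ (Fin 3)) 1, ℂ) :=
    sphereForm ![a * c - b * e, Complex.I * (a * c + b * e), a * e + b * c]
  have hcurve : ∀ t : ℂ, sphereForm (spinorVec (a + t * c) (b + t * e)) =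
      q + t • ((2 : ℂ) • B) + t ^ 2 • p := by
    intro t
    ext θ
    simp [q, B, p, linForm, Fin.sum_univ_three, spinorVec]
    ring
  have hB : B * B = q * p + (a * e - b * c) ^ 2 • 1 := by
    ext θ
    have h1 := sphere_sum_sq θ
    simp [q, B, p, linForm, Fin.sum_univ_three, spinorVec] at h1 ⊢
    linear_combination (a * e - b * c) ^ 2 * h1 - (a * e - b * c) ^ 2 *
      ((θ : EuclideanSpace ℝ (Fin 3)) 1 : ℂ) ^ 2 * Complex.I_sq
  have hd1 : ∀ t : ℂ, HasDerivAt (fun t : ℂ => q + t • ((2 : ℂ) • B) + t ^ 2 • p)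
      ((2 : ℂ) • B + (2 * t) • p) t := by
    intro t
    have h1 := ((hasDerivAt_id t).smul_const ((2 : ℂ) • B)).const_add q
    have h2 := ((hasDerivAt_pow 2 t).smul_const p)
    simpa using h1.fun_add h2
  -- For `m = 0` the product is itself a generator.
  rcases m with _ | m
  · simpa using h c e 1
  have hpow : ∀ (n : ℕ) (t : ℂ), HasDerivAt (fun t : ℂ => (q + t • ((2 : ℂ) • B) + t ^ 2 • p) ^ n)
      ((n : C(sphere (0 : EuclideanSpace ℝ (Fin 3)) 1, ℂ)) *
        (q + t • ((2 : ℂ) • B) + t ^ 2 • p) ^ (n - 1) * ((2 : ℂ) • B + (2 * t) • p)) t :=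
    fun n t => (hd1 t).fun_pow n
  have h1 : ∀ t : ℂ, (((m + 2 : ℕ) : C(sphere (0 : EuclideanSpace ℝ (Fin 3)) 1, ℂ)) *
        (q + t • ((2 : ℂ) • B) + t ^ 2 • p) ^ (m + 1) * ((2 : ℂ) • B + (2 * t) • p)) ∈ A :=
    fun t => mem_of_hasDerivAt hA (hpow (m + 2) t) fun s => by
      rw [← hcurve]; exact h _ _ _
  have hlin : HasDerivAt (fun t : ℂ => (2 : ℂ) • B + (2 * t) • p) ((2 : ℂ) • p) 0 := by
    simpa using (((hasDerivAt_id (0 : ℂ)).const_mul 2).smul_const p).const_add ((2 : ℂ) • B)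
  have h2 := mem_of_hasDerivAt hA (((hpow (m + 1) 0).const_mul _).mul hlin) h1
  -- `h2` is `(m + 2) (2 p q^{m+1} + 4 (m + 1) B² q^m)`; now `B²` is replaced using `hB`.
  have h3 : ((m + 2) * (2 + 4 * (m + 1)) : ℂ) • (p * q ^ (m + 1)) ∈ A := by
    have h4 := A.sub_mem h2 (A.smul_mem ((m + 2) * (4 * (m + 1)) * (a * e - b * c) ^ 2 : ℂ) (h a b m))
    convert h4 using 1
    ext θ
    have h5 := DFunLike.congr_fun hB θ
    simp at h5
    have h6 : (2 : C(sphere (0 : EuclideanSpace ℝ (Fin 3)) 1, ℂ)) θ = 2 := rfl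
    simp [h6]
    change _ = _ - _ * q θ ^ m
    linear_combination (-(m + 2) * (m + 1) * 4 * q θ ^ m) * h5
  have h7 := A.smul_mem (((m + 2) * (2 + 4 * (m + 1)) : ℂ)⁻¹) h3
  rwa [inv_smul_smul₀] at h7
  norm_cast

lemma isotropicPowers_dense_three :
    (Submodule.span ℂ (isotropicPowers 3)).topologicalClosure = ⊤ := by
  set G : Set C(sphere (0 : EuclideanSpace ℝ (Fin 3)) 1, ℂ) :=
    {p | ∃ a b m, p = sphereForm (spinorVec a b) ^ m} with hG
  have hsub : G ⊆ isotropicPowers 3 := by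
    rintro p ⟨a, b, m, rfl⟩
    exact ⟨_, m, sum_spinorVec_sq a b, rfl⟩
  rw [eq_top_iff, ← span_topologicalClosure_eq_top (G := G) ⟨0, 0, 0, by simp⟩]
  · exact Submodule.topologicalClosure_mono (Submodule.span_mono hsub)
  rintro i _ ⟨a, b, m, rfl⟩
  set A := (Submodule.span ℂ G).topologicalClosure
  have hq : ∀ c e, sphereForm (spinorVec c e) * sphereForm (spinorVec a b) ^ m ∈ A := by
    intro c e
    refine spinor_mul_pow_mem (Submodule.isClosed_topologicalClosure _) (fun a b m => ?_) a b c e m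
    exact Submodule.le_topologicalClosure _ (Submodule.subset_span ⟨a, b, m, rfl⟩)
  have h10 := hq 1 0
  have h01 := hq 0 1
  have h11 := hq 1 1
  fin_cases i
  · convert A.smul_mem (1 / 2 : ℂ) (A.sub_mem h10 h01) using 1
    ext θ
    simp [linForm, Fin.sum_univ_three, spinorVec]
    ring
  · convert A.smul_mem (-Complex.I / 2 : ℂ) (A.add_mem h10 h01) using 1
    ext θ
    simp [linForm, Fin.sum_univ_three, spinorVec]
    linear_combination ((θ : EuclideanSpace ℝ (Fin 3)) 1 : ℂ) *
      ((a ^ 2 - b ^ 2) * ((θ : EuclideanSpace ℝ (Fin 3)) 0 : ℂ) +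
        Complex.I * (a ^ 2 + b ^ 2) * ((θ : EuclideanSpace ℝ (Fin 3)) 1 : ℂ) +
        2 * a * b * ((θ : EuclideanSpace ℝ (Fin 3)) 2 : ℂ)) ^ m * Complex.I_sq
  · convert A.smul_mem (1 / 2 : ℂ) (A.sub_mem (A.sub_mem h11 h10) h01) using 1
    ext θ
    simp [linForm, Fin.sum_univ_three, spinorVec]
    ring

lemma isotropicPowers_dense_two :
    (Submodule.span ℂ (isotropicPowers 2)).topologicalClosure = ⊤ := by
  refine span_topologicalClosure_eq_top ⟨0, 0, by simp, by simp⟩ ?_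
  rintro i _ ⟨ζ, m, hζ, rfl⟩
  set A := (Submodule.span ℂ (isotropicPowers 2)).topologicalClosure
  have hmem : ∀ (ζ : Fin 2 → ℂ) (m : ℕ), ∑ i, ζ i ^ 2 = 0 → sphereForm ζ ^ m ∈ A :=
    fun ζ m h => Submodule.le_topologicalClosure _ (Submodule.subset_span ⟨ζ, m, h, rfl⟩)
  -- An isotropic vector in the plane is a multiple of `(1, ± i)`.
  obtain ⟨s, hs, hζs⟩ : ∃ s : ℂ, s ^ 2 = -1 ∧ ζ = ζ 0 • ![1, s] := by
    rw [Fin.sum_univ_two] at hζ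
    have : (ζ 1 - Complex.I * ζ 0) * (ζ 1 + Complex.I * ζ 0) = 0 := by
      linear_combination hζ - ζ 0 ^ 2 * Complex.I_sq
    rcases mul_eq_zero.1 this with h | h
    · refine ⟨Complex.I, Complex.I_sq, ?_⟩
      ext j
      fin_cases j
      · simp
      · simp; linear_combination h
    · refine ⟨-Complex.I, by simp, ?_⟩
      ext j
      fin_cases j
      · simp
      · simp; linear_combination h
  have hpow : sphereForm ζ ^ m = ζ 0 ^ m • sphereForm ![1, s] ^ m := by
    rw [← smul_pow]
    congr 1
    conv_lhs => rw [hζs]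
    ext θ
    simp [linForm, mul_add, mul_assoc]
  have hα : sphereForm ![1, s] * sphereForm ![1, s] ^ m ∈ A := by
    rw [← pow_succ']
    exact hmem _ _ (by simp [hs])
  have hγ : sphereForm ![1, -s] * sphereForm ![1, s] ^ m ∈ A := by
    rcases m with _ | m
    · simpa using hmem ![1, -s] 1 (by simp [hs])
    · have : sphereForm ![1, -s] * sphereForm ![1, s] = 1 := by
        ext θ
        have h1 := sphere_sum_sq θ
        simp [linForm] at h1 ⊢
        linear_combination h1 - ((θ : EuclideanSpace ℝ (Fin 2)) 1 : ℂ) ^ 2 * hs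
      rw [pow_succ', ← mul_assoc, this, one_mul]
      exact hmem _ _ (by simp [hs])
  rw [hpow, mul_smul_comm]
  refine A.smul_mem _ ?_
  fin_cases i
  · convert A.smul_mem (1 / 2 : ℂ) (A.add_mem hα hγ) using 1
    ext θ
    simp [linForm]
    ring
  · convert A.smul_mem (-s / 2 : ℂ) (A.sub_mem hα hγ) using 1
    ext θ
    simp [linForm]
    linear_combination ((θ : EuclideanSpace ℝ (Fin 2)) 1 : ℂ) *
      (((θ : EuclideanSpace ℝ (Fin 2)) 0 : ℂ) + s * ((θ : EuclideanSpace ℝ (Fin 2)) 1 : ℂ)) ^ m * hs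

/-! ### Spherical moments of radiating solutions -/

/-- Integration in polar coordinates. -/
lemma integral_eq_integral_polar {d : ℕ} [NeZero d] {Φ : EuclideanSpace ℝ (Fin d) → ℂ}
    (hΦ : Integrable Φ) :
    ∫ x, Φ x = ∫ r in Ioi (0 : ℝ), ((r ^ (d - 1) : ℝ) : ℂ) *
      ∫ θ, Φ (r • (θ : EuclideanSpace ℝ (Fin d))) ∂(volume : Measure
        (EuclideanSpace ℝ (Fin d))).toSphere := by
  set μ : Measure (EuclideanSpace ℝ (Fin d)) := volume
  have hmp := μ.measurePreserving_homeomorphUnitSphereProd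
  have hemb := (homeomorphUnitSphereProd (EuclideanSpace ℝ (Fin d))).measurableEmbedding
  rw [finrank_euclideanSpace_fin] at hmp
  set Ψ : sphere (0 : EuclideanSpace ℝ (Fin d)) 1 × Ioi (0 : ℝ) → ℂ :=
    fun p => Φ ((p.2 : ℝ) • (p.1 : EuclideanSpace ℝ (Fin d)))
  have hΨ : ∀ x : ({0}ᶜ : Set (EuclideanSpace ℝ (Fin d))),
      Ψ (homeomorphUnitSphereProd _ x) = Φ x := by
    intro x
    have hx : ‖(x : EuclideanSpace ℝ (Fin d))‖ ≠ 0 := norm_ne_zero_iff.2 x.2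
    simp [Ψ, smul_smul, hx]
  have hint : Integrable Ψ (μ.toSphere.prod (Measure.volumeIoiPow (d - 1))) := by
    rw [← hmp.integrable_comp_emb hemb]
    have h1 : Integrable (fun x : ({0}ᶜ : Set (EuclideanSpace ℝ (Fin d))) => Φ x)
        (μ.comap (↑)) :=
      (integrableOn_iff_comap_subtypeVal (measurableSet_singleton _).compl).1 hΦ.integrableOn
    refine h1.congr (Eventually.of_forall fun x => ?_)
    exact (hΨ x).symm
  calc ∫ x, Φ x = ∫ x : ({0}ᶜ : Set (EuclideanSpace ℝ (Fin d))), Φ x ∂(μ.comap (↑)) := by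
        rw [integral_subtype_comap (measurableSet_singleton _).compl, restrict_compl_singleton]
    _ = ∫ p, Ψ p ∂(μ.toSphere.prod (Measure.volumeIoiPow (d - 1))) := by
        rw [← hmp.integral_comp hemb]
        simp only [hΨ]
    _ = ∫ r, ∫ θ, Ψ (θ, r) ∂μ.toSphere ∂(Measure.volumeIoiPow (d - 1)) :=
        integral_prod_symm _ hint
    _ = _ := by
        simp only [Measure.volumeIoiPow, ENNReal.ofReal]
        rw [integral_withDensity_eq_integral_smul
          ((measurable_subtype_coe.pow_const _).real_toNNReal),
          integral_subtype_comap measurableSet_Ioi fun r : ℝ => Real.toNNReal (r ^ (d - 1)) •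
            ∫ θ, Φ (r • (θ : EuclideanSpace ℝ (Fin d))) ∂μ.toSphere]
        refine setIntegral_congr_fun measurableSet_Ioi fun r hr => ?_
        simp only [NNReal.smul_def]
        rw [Real.coe_toNNReal _ (pow_nonneg (mem_Ioi.1 hr).le _), Complex.real_smul]

lemma IsTestFunction.continuous_laplacian {d : ℕ} {Ω : Set (EuclideanSpace ℝ (Fin d))}
    {φ : EuclideanSpace ℝ (Fin d) → ℂ} (hφ : IsTestFunction Ω φ) : Continuous (Δ φ) := by
  rw [InnerProductSpace.laplacian_eq_iteratedFDeriv_stdOrthonormalBasis]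
  refine continuous_finsetSum _ fun i _ => ?_
  have h := (contDiff_infty.1 hφ.contDiff 2).continuous_iteratedFDeriv (m := 2) le_rfl
  exact (ContinuousMultilinearMap.apply ℝ (fun _ : Fin 2 => EuclideanSpace ℝ (Fin d)) ℂ
    _).continuous.comp h

lemma IsTestFunction.hasCompactSupport_laplacian {d : ℕ} {Ω : Set (EuclideanSpace ℝ (Fin d))}
    {φ : EuclideanSpace ℝ (Fin d) → ℂ} (hφ : IsTestFunction Ω φ) : HasCompactSupport (Δ φ) := by
  refine (hφ.hasCompactSupport.iteratedFDeriv (𝕜 := ℝ) 2).mono fun x hx => ?_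
  contrapose! hx
  rw [Function.notMem_support] at hx ⊢
  rw [InnerProductSpace.laplacian_eq_iteratedFDeriv_stdOrthonormalBasis]
  simp [hx]

lemma IsTestFunction.integrable_mul_helmholtz {d : ℕ} {Ω : Set (EuclideanSpace ℝ (Fin d))}
    {φ w : EuclideanSpace ℝ (Fin d) → ℂ} (hφ : IsTestFunction Ω φ) (hw : Continuous w) (k : ℂ) :
    Integrable fun x => w x * (Δ φ x + k ^ 2 * φ x) := by
  refine Continuous.integrable_of_hasCompactSupport ?_ ?_
  · exact hw.mul (hφ.continuous_laplacian.add (continuous_const.mul hφ.contDiff.continuous))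
  · exact (hφ.hasCompactSupport_laplacian.add hφ.hasCompactSupport.mul_left).mul_left

/-- The moment `∫_S w(rθ) p(θ) dσ(θ)` of a function on `ℝ^d` over the sphere of radius `r`. -/
noncomputable def sphereMoment {d : ℕ} (w : EuclideanSpace ℝ (Fin d) → ℂ)
    (p : C(sphere (0 : EuclideanSpace ℝ (Fin d)) 1, ℂ)) (r : ℝ) : ℂ :=
  ∫ θ, w (r • (θ : EuclideanSpace ℝ (Fin d))) * p θ ∂(volume : Measure
    (EuclideanSpace ℝ (Fin d))).toSphere

section Moments

variable {d : ℕ} {w : EuclideanSpace ℝ (Fin d) → ℂ}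

lemma continuous_sphereMoment (hw : Continuous w)
    (p : C(sphere (0 : EuclideanSpace ℝ (Fin d)) 1, ℂ)) : Continuous (sphereMoment w p) := by
  have h : Continuous (Function.uncurry fun (r : ℝ)
      (θ : sphere (0 : EuclideanSpace ℝ (Fin d)) 1) =>
        w (r • (θ : EuclideanSpace ℝ (Fin d))) * p θ) := by
    simp only [Function.uncurry_def]
    fun_prop
  have := continuous_parametric_integral_of_continuous (μ := (volume : Measure
    (EuclideanSpace ℝ (Fin d))).toSphere) h isCompact_univ
  rw [Measure.restrict_univ] at this
  exact this

lemma integrable_sphereMoment (hw : Continuous w)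
    (p : C(sphere (0 : EuclideanSpace ℝ (Fin d)) 1, ℂ)) (r : ℝ) :
    Integrable (fun θ : sphere (0 : EuclideanSpace ℝ (Fin d)) 1 =>
      w (r • (θ : EuclideanSpace ℝ (Fin d))) * p θ)
      (volume : Measure (EuclideanSpace ℝ (Fin d))).toSphere := by
  have h : Continuous fun θ : sphere (0 : EuclideanSpace ℝ (Fin d)) 1 =>
      w (r • (θ : EuclideanSpace ℝ (Fin d))) * p θ := by fun_prop
  exact h.integrable_of_hasCompactSupport (HasCompactSupport.of_compactSpace _)

/-- The radiation condition is inherited by spherical moments. No derivative under the integral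
sign is needed: far out, `e^{-ikr} w(rθ)` has a small Lipschitz constant in `r`, and so has its
average over `θ`. -/
lemma tendsto_sphereMoment_radiation {k : ℝ} (hw : Continuous w) (hd : 1 ≤ d)
    (hrad : SommerfeldRadiation k w) (p : C(sphere (0 : EuclideanSpace ℝ (Fin d)) 1, ℂ))
    {ρ : ℝ} {V' : ℝ → ℂ} (hV : ∀ r, ρ < r → HasDerivAt (sphereMoment w p) (V' r) r) :
    Tendsto (fun r : ℝ => ((r ^ (((d : ℝ) - 1) / 2) : ℝ) : ℂ) *
      (V' r - Complex.I * k * sphereMoment w p r)) atTop (nhds 0) := by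
  set σ := (volume : Measure (EuclideanSpace ℝ (Fin d))).toSphere
  set c : ℝ := ((d : ℝ) - 1) / 2 with hc
  have hc0 : 0 ≤ c := by
    have : (1 : ℝ) ≤ d := by exact_mod_cast hd
    rw [hc]; linarith
  set K : ℝ := ‖p‖ * σ.real univ with hK
  have hK0 : 0 ≤ K := by positivity
  set e : ℝ → ℂ := fun r => Complex.exp (-(Complex.I * k * r)) with he
  have hen : ∀ r, ‖e r‖ = 1 := by
    intro r
    have : -(Complex.I * k * r) = ((-(k * r) : ℝ) : ℂ) * Complex.I := by push_cast; ring
    rw [he]; simp only [this, Complex.norm_exp_ofReal_mul_I]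
  have hed : ∀ r : ℝ, HasDerivAt e (e r * -(Complex.I * k)) r := by
    intro r
    have := ((hasDerivAt_id r).ofReal_comp.const_mul (Complex.I * k)).neg.cexp
    simpa [he] using this
  rw [Metric.tendsto_atTop]
  intro ε hε
  obtain ⟨r₀, hr₀, h⟩ := hrad (ε / (2 * (K + 1))) (by positivity)
  refine ⟨max r₀ (ρ + 1), fun r hr => ?_⟩
  have hr1 : r₀ ≤ r := (le_max_left _ _).trans hr
  have hr2 : ρ < r := by linarith [(le_max_right r₀ (ρ + 1)).trans hr]
  have hr0 : 0 < r := hr₀.trans_le hr1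
  have hrc : 0 < r ^ c := Real.rpow_pos_of_pos hr0 c
  set η := ε / (2 * (K + 1)) / r ^ c with hη
  have hη0 : 0 ≤ η := by positivity
  -- The Lipschitz bound along each ray, from the mean value inequality.
  have hray : ∀ (θ : sphere (0 : EuclideanSpace ℝ (Fin d)) 1) (s : ℝ), r ≤ s →
      ‖e s * w (s • (θ : EuclideanSpace ℝ (Fin d))) -
        e r * w (r • (θ : EuclideanSpace ℝ (Fin d)))‖ ≤ η * ‖s - r‖ := by
    intro θ s hs
    refine (convex_Ici r).norm_image_sub_le_of_norm_hasDerivWithin_le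
      (f := fun t => e t * w (t • (θ : EuclideanSpace ℝ (Fin d))))
      (f' := fun t => e t * (fderiv ℝ w (t • (θ : EuclideanSpace ℝ (Fin d))) θ -
        Complex.I * k * w (t • (θ : EuclideanSpace ℝ (Fin d))))) (fun t ht => ?_) (fun t ht => ?_)
      (mem_Ici.2 le_rfl) (mem_Ici.2 hs)
    · have ht0 : 0 < t := hr0.trans_le ht
      have hnorm : ‖t • (θ : EuclideanSpace ℝ (Fin d))‖ = t := by
        simp [norm_smul, abs_of_pos ht0]
      have hdiff := (h (t • (θ : EuclideanSpace ℝ (Fin d)))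
        (by rw [hnorm]; exact hr1.trans ht)).1
      have hl : HasDerivAt (fun t : ℝ => t • (θ : EuclideanSpace ℝ (Fin d))) θ t := by
        simpa using (hasDerivAt_id t).smul_const (θ : EuclideanSpace ℝ (Fin d))
      have h1 := hdiff.hasFDerivAt.comp_hasDerivAt t hl
      refine (((hed t).mul h1).congr_deriv ?_).hasDerivWithinAt
      simp only [Function.comp_apply]
      ring
    · have ht0 : 0 < t := hr0.trans_le ht
      have hnorm : ‖t • (θ : EuclideanSpace ℝ (Fin d))‖ = t := by
        simp [norm_smul, abs_of_pos ht0]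
      have h1 := (h (t • (θ : EuclideanSpace ℝ (Fin d)))
        (by rw [hnorm]; exact hr1.trans ht)).2
      rw [hnorm, smul_smul, inv_mul_cancel₀ ht0.ne', one_smul] at h1
      rw [norm_mul, hen, one_mul, hη, le_div_iff₀ hrc, mul_comm]
      refine le_trans ?_ h1
      gcongr
      exact ht
  have hmom : ∀ s : ℝ, r ≤ s →
      ‖e s * sphereMoment w p s - e r * sphereMoment w p r‖ ≤ K * η * ‖s - r‖ := by
    intro s hs
    have h1 : e s * sphereMoment w p s - e r * sphereMoment w p r =
        ∫ θ, (e s * w (s • (θ : EuclideanSpace ℝ (Fin d))) -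
          e r * w (r • (θ : EuclideanSpace ℝ (Fin d)))) * p θ ∂σ := by
      rw [sphereMoment, sphereMoment, ← integral_const_mul, ← integral_const_mul,
        ← integral_sub ((integrable_sphereMoment hw p s).const_mul _)
          ((integrable_sphereMoment hw p r).const_mul _)]
      refine integral_congr_ae (Eventually.of_forall fun θ => ?_)
      simp only
      ring
    rw [h1]
    refine (norm_integral_le_of_norm_le_const (C := η * ‖s - r‖ * ‖p‖)
      (Eventually.of_forall fun θ => ?_)).trans (le_of_eq ?_)
    · rw [norm_mul]
      exact mul_le_mul (hray θ s hs) (p.norm_coe_le_norm θ) (norm_nonneg _) (by positivity)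
    · rw [hK]; ring
  have hder := (hed r).mul (hV r hr2)
  have hsub : Ioi r ⊆ {r}ᶜ := fun s hs => ne_of_gt hs
  have hslope := (hasDerivAt_iff_tendsto_slope.1 hder).norm.mono_left
    (nhdsWithin_mono r hsub)
  have hle : ‖e r * -(Complex.I * k) * sphereMoment w p r + e r * V' r‖ ≤ K * η := by
    refine le_of_tendsto hslope ?_
    filter_upwards [self_mem_nhdsWithin] with s hs
    have hs' : 0 < s - r := sub_pos.2 hs
    rw [slope_def_module, norm_smul, norm_inv, ← div_eq_inv_mul, div_le_iff₀ (by
      rw [Real.norm_eq_abs]; positivity)]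
    exact hmom s (le_of_lt hs)
  have heq : e r * -(Complex.I * k) * sphereMoment w p r + e r * V' r =
      e r * (V' r - Complex.I * k * sphereMoment w p r) := by ring
  rw [heq, norm_mul, hen, one_mul] at hle
  rw [dist_zero_right, norm_mul, Complex.norm_real, Real.norm_eq_abs, abs_of_pos hrc]
  calc r ^ c * ‖V' r - Complex.I * k * sphereMoment w p r‖ ≤ r ^ c * (K * η) := by gcongr
    _ = ε * (K / (2 * (K + 1))) := by rw [hη]; field_simp
    _ < ε * 1 := by
        gcongr
        rw [div_lt_one (by positivity)]
        linarith
    _ = ε := mul_one ε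

end Moments

lemma IsRayTest.rpow_mul {ρ : ℝ} (hρ : 0 ≤ ρ) {χ : ℝ → ℂ} (hχ : IsRayTest ρ χ) (s : ℝ) :
    IsRayTest ρ fun r => ((r ^ s : ℝ) : ℂ) * χ r := by
  obtain ⟨h1, a, b, ha, h⟩ := hχ
  refine ⟨contDiff_iff_contDiffAt.2 fun r => ?_, a, b, ha, fun x hx => by simp [h x hx]⟩
  rcases lt_or_ge r a with hr | hr
  · refine (contDiffAt_const (c := (0 : ℂ))).congr_of_eventuallyEq ?_
    filter_upwards [isOpen_Iio.mem_nhds hr] with t ht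
    simp [h t fun h' => h'.1.not_gt ht]
  · exact (Complex.ofRealCLM.contDiff.contDiffAt.comp r
      (Real.contDiffAt_rpow_const_of_ne (by linarith))).mul h1.contDiffAt

lemma isTestFunction_radial_mul_linForm {d : ℕ} {ρ : ℝ} (hρ : 0 ≤ ρ) {φ : ℝ → ℂ}
    (hφ : IsRayTest ρ φ) (ζ : Fin d → ℂ) (m : ℕ) :
    IsTestFunction univ fun x : EuclideanSpace ℝ (Fin d) => φ ‖x‖ * linForm ζ x ^ m := by
  obtain ⟨h1, a, b, ha, h⟩ := hφ
  refine ⟨contDiff_iff_contDiffAt.2 fun x => ?_, ?_, subset_univ _⟩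
  · rcases eq_or_ne x 0 with rfl | hx
    · refine (contDiffAt_const (c := (0 : ℂ))).congr_of_eventuallyEq ?_
      filter_upwards [ball_mem_nhds (0 : EuclideanSpace ℝ (Fin d)) (hρ.trans_lt ha)] with y hy
      simp [h ‖y‖ fun h' => h'.1.not_gt (by simpa using hy)]
    · exact (h1.contDiffAt.comp x (contDiffAt_norm ℝ hx)).mul
        ((contDiff_linForm ζ).pow m).contDiffAt
  · refine HasCompactSupport.intro (isCompact_closedBall 0 b) fun x hx => ?_
    simp [h ‖x‖ fun h' => hx (by simpa using h'.2)]

section Vanishing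

variable {d : ℕ} {k ρ R : ℝ} {F w : EuclideanSpace ℝ (Fin d) → ℂ}

/-- Against `(ζ·x)^m` with `ζ·ζ = 0`, the Helmholtz equation becomes an ordinary differential
equation for the moment `v`: the function `y = r^{(d-1)/2} v` satisfies
`y'' = (a(a-1) / r² - k²) y` weakly outside the support of the source, `a = (d-1)/2 + m`. The test
function is `r^{-a} χ(r) (ζ·x)^m`, where the factor `r^{-a}` removes the first order term. -/
lemma sphereMoment_weak_ode [NeZero d] (hw : Continuous w) (hρ : 0 < ρ)
    (hF : ∀ᵐ x, ρ < ‖x‖ → F x = 0) (hsol : SolvesHelmholtz k F w) {ζ : Fin d → ℂ}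
    (hζ : ∑ i, ζ i ^ 2 = 0) (m : ℕ) {a : ℝ} (ha : a = ((d : ℝ) - 1) / 2 + m)
    {χ : ℝ → ℂ} (hχ : IsRayTest ρ χ) :
    ∫ r, (((r ^ (((d : ℝ) - 1) / 2) : ℝ) : ℂ) * sphereMoment w (sphereForm ζ ^ m) r) *
      deriv (deriv χ) r = ∫ r, (((a * (a - 1) / (max r ρ) ^ 2 - k ^ 2 : ℝ) : ℂ) *
        (((r ^ (((d : ℝ) - 1) / 2) : ℝ) : ℂ) * sphereMoment w (sphereForm ζ ^ m) r)) * χ r := by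
  have hd : 1 ≤ d := NeZero.one_le
  set c : ℝ := ((d : ℝ) - 1) / 2 with hc
  have hc0 : 0 ≤ c := by
    have : (1 : ℝ) ≤ d := by exact_mod_cast hd
    rw [hc]; linarith
  set v := sphereMoment w (sphereForm ζ ^ m) with hv
  have hyc : Continuous fun r : ℝ => ((r ^ c : ℝ) : ℂ) * v r :=
    (Complex.continuous_ofReal.comp (Real.continuous_rpow_const hc0)).mul
      (continuous_sphereMoment hw _)
  have hqc : Continuous fun r : ℝ => ((a * (a - 1) / (max r ρ) ^ 2 - k ^ 2 : ℝ) : ℂ) := by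
    refine Complex.continuous_ofReal.comp ((continuous_const.div (by fun_prop) fun r => ?_).sub
      continuous_const)
    have : 0 < max r ρ := lt_max_of_lt_right hρ
    positivity
  set φ : ℝ → ℂ := fun r => ((r ^ (-a) : ℝ) : ℂ) * χ r with hφdef
  have hφ : IsRayTest ρ φ := hχ.rpow_mul hρ.le (-a)
  -- The first two derivatives of `φ = r^{-a} χ`.
  have hφ1 : ∀ r, 0 < r → deriv φ r =
      ((r ^ (-a) : ℝ) : ℂ) * (deriv χ r - a / r * χ r) := by
    intro r hr
    have h1 := (Real.hasDerivAt_rpow_const (x := r) (p := -a) (Or.inl hr.ne')).ofReal_comp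
    rw [(h1.fun_mul (hχ.hasDerivAt r)).deriv, Real.rpow_sub_one hr.ne']
    have : (r : ℂ) ≠ 0 := by exact_mod_cast hr.ne'
    push_cast
    field_simp
    ring
  have hφ2 : ∀ r, 0 < r → deriv (deriv φ) r = ((r ^ (-a) : ℝ) : ℂ) *
      (deriv (deriv χ) r - 2 * a / r * deriv χ r + a * (a + 1) / r ^ 2 * χ r) := by
    intro r hr
    have h0 : (r : ℂ) ≠ 0 := by exact_mod_cast hr.ne'
    have hev : deriv φ =ᶠ[nhds r] fun r =>
        ((r ^ (-a) : ℝ) : ℂ) * (deriv χ r - a * ((r⁻¹ : ℝ) : ℂ) * χ r) := by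
      filter_upwards [isOpen_Ioi.mem_nhds hr] with t ht
      rw [hφ1 t ht]; push_cast; ring
    rw [hev.deriv_eq]
    have h1 := (Real.hasDerivAt_rpow_const (x := r) (p := -a) (Or.inl hr.ne')).ofReal_comp
    have h2 := ((hasDerivAt_inv hr.ne').ofReal_comp.const_mul (a : ℂ)).fun_mul (hχ.hasDerivAt r)
    rw [(h1.fun_mul ((hχ.deriv.hasDerivAt r).fun_sub h2)).deriv, Real.rpow_sub_one hr.ne']
    push_cast
    field_simp
    ring
  have hΦ := isTestFunction_radial_mul_linForm hρ.le hφ ζ m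
  have h0 : ∫ x, F x * (φ ‖x‖ * linForm ζ x ^ m) = 0 := by
    refine integral_eq_zero_of_ae ?_
    filter_upwards [hF] with x hx
    rcases lt_or_ge ρ ‖x‖ with h | h
    · simp [hx h]
    · obtain ⟨-, a', b', ha', h'⟩ := hφ
      simp [h' ‖x‖ fun hx' => (ha'.trans_le hx'.1).not_ge h]
  have h1 := hsol _ hΦ
  rw [h0, integral_eq_integral_polar (hΦ.integrable_mul_helmholtz hw k)] at h1
  have h2 : ∀ r ∈ Ioi (0 : ℝ), ((r ^ (d - 1) : ℝ) : ℂ) *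
      (∫ θ, w (r • (θ : EuclideanSpace ℝ (Fin d))) *
        (Δ (fun x : EuclideanSpace ℝ (Fin d) => φ ‖x‖ * linForm ζ x ^ m)
          (r • (θ : EuclideanSpace ℝ (Fin d))) + (k : ℂ) ^ 2 *
          (φ ‖r • (θ : EuclideanSpace ℝ (Fin d))‖ *
            linForm ζ (r • (θ : EuclideanSpace ℝ (Fin d))) ^ m))
        ∂(volume : Measure (EuclideanSpace ℝ (Fin d))).toSphere) =
      (((r ^ c : ℝ) : ℂ) * v r) * deriv (deriv χ) r -
        (((a * (a - 1) / (max r ρ) ^ 2 - k ^ 2 : ℝ) : ℂ) * (((r ^ c : ℝ) : ℂ) * v r)) * χ r := by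
    intro r hr
    have hr0 : 0 < r := hr
    have hrC : (r : ℂ) ≠ 0 := by exact_mod_cast hr0.ne'
    have h3 : ∀ θ : sphere (0 : EuclideanSpace ℝ (Fin d)) 1,
        w (r • (θ : EuclideanSpace ℝ (Fin d))) *
        (Δ (fun x : EuclideanSpace ℝ (Fin d) => φ ‖x‖ * linForm ζ x ^ m)
          (r • (θ : EuclideanSpace ℝ (Fin d))) + (k : ℂ) ^ 2 *
          (φ ‖r • (θ : EuclideanSpace ℝ (Fin d))‖ *
            linForm ζ (r • (θ : EuclideanSpace ℝ (Fin d))) ^ m)) =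
        ((deriv (deriv φ) r + (d - 1 + 2 * m) / r * deriv φ r + (k : ℂ) ^ 2 * φ r) * r ^ m) *
          (w (r • (θ : EuclideanSpace ℝ (Fin d))) * (sphereForm ζ ^ m) θ) := by
      intro θ
      have hnorm : ‖r • (θ : EuclideanSpace ℝ (Fin d))‖ = r := by
        simp [norm_smul, abs_of_pos hr0]
      rw [laplacian_radial_mul_isotropic hζ m (φ' := deriv φ) (φ'' := deriv (deriv φ))
        (contDiff_infty.1 hφ.1 2) hφ.hasDerivAt hφ.deriv.hasDerivAt
        (by rw [← norm_ne_zero_iff, hnorm]; exact hr0.ne'), hnorm, linForm_smul]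
      simp only [ContinuousMap.pow_apply, sphereForm_apply]
      ring
    simp only [h3]
    rw [integral_const_mul]
    change _ * (_ * v r) = _
    rcases lt_or_ge ρ r with hrρ | hrρ
    · rw [hφ2 r hr0, hφ1 r hr0, max_eq_left hrρ.le, hφdef]
      have h4 : ((r ^ (d - 1) : ℝ) : ℂ) * ((r ^ (-a) : ℝ) : ℂ) * (r : ℂ) ^ m =
          ((r ^ c : ℝ) : ℂ) := by
        rw [← Complex.ofReal_pow, ← Complex.ofReal_mul, ← Complex.ofReal_mul, ← Real.rpow_natCast,
          ← Real.rpow_natCast, ← Real.rpow_add hr0, ← Real.rpow_add hr0]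
        congr 2
        rw [Nat.cast_sub hd, ha, hc]
        push_cast
        ring
      rw [← h4]
      have h5 : (d : ℂ) - 1 + 2 * m = 2 * a := by
        rw [ha, hc]; push_cast; ring
      rw [h5]
      push_cast
      field_simp
      ring
    · have hz : ∀ {ψ : ℝ → ℂ}, IsRayTest ρ ψ → ψ r = 0 := by
        rintro ψ ⟨-, a', b', ha', h'⟩
        exact h' r fun hx' => (ha'.trans_le hx'.1).not_ge hrρ
      simp [hz hφ, hz hφ.deriv, hz hφ.deriv.deriv, hz hχ, hz hχ.deriv.deriv]
  have hint : Integrable fun r : ℝ => (((a * (a - 1) / (max r ρ) ^ 2 - k ^ 2 : ℝ) : ℂ) *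
      (((r ^ c : ℝ) : ℂ) * v r)) * χ r := hχ.integrable_mul (hqc.mul hyc)
  rw [setIntegral_congr_fun measurableSet_Ioi h2,
    setIntegral_eq_integral_of_forall_compl_eq_zero (fun r hr => ?_),
    integral_sub (hχ.deriv.deriv.integrable_mul hyc) hint] at h1
  · exact sub_eq_zero.1 h1
  · have hz : ∀ {ψ : ℝ → ℂ}, IsRayTest ρ ψ → ψ r = 0 := by
      rintro ψ ⟨-, a', b', ha', h'⟩
      exact h' r fun hx' => hr (hρ.trans (ha'.trans_le hx'.1))
    simp [hz hχ, hz hχ.deriv.deriv]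

/-- The moments against isotropic powers vanish: the weak equation holds classically, `y` inherits the
radiation condition, and `y(R) = 0`, so the one-dimensional Rellich lemma applies. -/
lemma sphereMoment_isotropic_eq_zero [NeZero d] (hk : 0 < k) (hw : Continuous w) (hρ : 0 < ρ)
    (hρR : ρ < R) (hF : ∀ᵐ x, ρ < ‖x‖ → F x = 0) (hsol : SolvesHelmholtz k F w)
    (hrad : SommerfeldRadiation k w)
    (hR : ∀ x ∈ sphere (0 : EuclideanSpace ℝ (Fin d)) R, w x = 0) {ζ : Fin d → ℂ}
    (hζ : ∑ i, ζ i ^ 2 = 0) (m : ℕ) {r : ℝ} (hr : ρ < r) :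
    sphereMoment w (sphereForm ζ ^ m) r = 0 := by
  have hd : 1 ≤ d := NeZero.one_le
  set c : ℝ := ((d : ℝ) - 1) / 2 with hc
  have hc0 : 0 ≤ c := by
    have : (1 : ℝ) ≤ d := by exact_mod_cast hd
    rw [hc]; linarith
  set a : ℝ := c + m
  set v := sphereMoment w (sphereForm ζ ^ m) with hv
  set y : ℝ → ℂ := fun r => ((r ^ c : ℝ) : ℂ) * v r with hy
  have hyc : Continuous y :=
    (Complex.continuous_ofReal.comp (Real.continuous_rpow_const hc0)).mul
      (continuous_sphereMoment hw _)
  have hqc : Continuous fun r : ℝ => ((a * (a - 1) / (max r ρ) ^ 2 - k ^ 2 : ℝ) : ℂ) := by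
    refine Complex.continuous_ofReal.comp ((continuous_const.div (by fun_prop) fun r => ?_).sub
      continuous_const)
    have : 0 < max r ρ := lt_max_of_lt_right hρ
    positivity
  obtain ⟨y', hy'⟩ := exists_hasDerivAt_of_weak_second_deriv (ρ := ρ) hyc (hqc.mul hyc)
    fun χ hχ => sphereMoment_weak_ode hw hρ hF hsol hζ m rfl hχ
  have hne : ∀ r, ρ < r → ((r ^ c : ℝ) : ℂ) ≠ 0 := fun r hr => by
    exact_mod_cast (Real.rpow_pos_of_pos (hρ.trans hr) c).ne'
  set V' : ℝ → ℂ := fun r => ((r ^ c : ℝ) : ℂ)⁻¹ * (y' r - (c / r : ℝ) * y r) with hV'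
  have hV : ∀ r, ρ < r → HasDerivAt v (V' r) r := by
    intro r hr
    have hr0 : 0 < r := hρ.trans hr
    have h0 : (r : ℂ) ≠ 0 := by exact_mod_cast hr0.ne'
    have h1 := ((Real.hasDerivAt_rpow_const (x := r) (p := c) (Or.inl hr0.ne')).ofReal_comp)
    have h2 := (hy' r hr).1.div h1 (hne r hr)
    refine (h2.congr_of_eventuallyEq ?_).congr_deriv ?_
    · filter_upwards [isOpen_Ioi.mem_nhds hr] with t ht
      simp only [hy, Pi.div_apply]
      rw [mul_div_cancel_left₀ _ (hne t ht)]
    · rw [Real.rpow_sub_one hr0.ne', hV']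
      have := hne r hr
      push_cast
      field_simp
  have hrad' := tendsto_sphereMoment_radiation hw hd hrad (sphereForm ζ ^ m) hV
  have hzero := eq_zero_of_radiating_ode (μ := a * (a - 1)) (c := c) hρ.le hρR hk
    (fun r hr => (hy' r hr).1)
    (fun r hr => by simpa [max_eq_left (le_of_lt hr)] using (hy' r hr).2)
    (by
      have : v R = 0 := by
        simp only [hv, sphereMoment]
        refine integral_eq_zero_of_ae (Eventually.of_forall fun θ => ?_)
        simp only [Pi.zero_apply]
        rw [hR _ (by simp [norm_smul, abs_of_pos (hρ.trans hρR)]), zero_mul]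
      simp [hy, this])
    (hrad'.congr' (by
      filter_upwards [eventually_gt_atTop ρ] with r hr
      have := hne r hr
      simp only [hV', hy]
      change _ * (_ - _ * v r) = _
      field_simp
      ring))
    r hr
  exact (mul_eq_zero.1 hzero).resolve_left (hne r hr)

/-- Rellich's lemma with Dirichlet condition on one sphere, in terms of spherical moments: a
radiating solution that vanishes on the sphere of radius `R` is zero outside the support of the
source. -/
lemma sphereMoment_eq_zero [NeZero d] (hd : d = 2 ∨ d = 3) (hk : 0 < k) (hw : Continuous w)
    (hρ : 0 < ρ) (hρR : ρ < R) (hF : ∀ᵐ x, ρ < ‖x‖ → F x = 0) (hsol : SolvesHelmholtz k F w)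
    (hrad : SommerfeldRadiation k w)
    (hR : ∀ x ∈ sphere (0 : EuclideanSpace ℝ (Fin d)) R, w x = 0)
    (p : C(sphere (0 : EuclideanSpace ℝ (Fin d)) 1, ℂ)) {r : ℝ} (hr : ρ < r) :
    sphereMoment w p r = 0 := by
  let L : C(sphere (0 : EuclideanSpace ℝ (Fin d)) 1, ℂ) →ₗ[ℂ] ℂ :=
    { toFun := fun p => sphereMoment w p r
      map_add' := fun p q => by
        simp only [sphereMoment, ContinuousMap.add_apply, mul_add]
        exact integral_add (integrable_sphereMoment hw p r) (integrable_sphereMoment hw q r)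
      map_smul' := fun c p => by
        simp only [sphereMoment, ContinuousMap.smul_apply, smul_eq_mul, mul_left_comm _ c,
          RingHom.id_apply]
        exact integral_const_mul _ _ }
  let g : C(sphere (0 : EuclideanSpace ℝ (Fin d)) 1, ℂ) :=
    ⟨fun θ => w (r • (θ : EuclideanSpace ℝ (Fin d))), by fun_prop⟩
  have hL : Continuous L := by
    refine AddMonoidHomClass.continuous_of_bound L (‖g‖ * (volume : Measure
      (EuclideanSpace ℝ (Fin d))).toSphere.real univ) fun p => ?_
    refine (norm_integral_le_of_norm_le_const (C := ‖g‖ * ‖p‖)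
      (Eventually.of_forall fun θ => ?_)).trans (le_of_eq (by ring))
    rw [norm_mul]
    exact mul_le_mul (g.norm_coe_le_norm θ) (p.norm_coe_le_norm θ) (norm_nonneg _) (norm_nonneg _)
  have hle : (Submodule.span ℂ (isotropicPowers d)).topologicalClosure ≤ LinearMap.ker L := by
    refine Submodule.topologicalClosure_minimal _ (Submodule.span_le.2 ?_)
      (isClosed_singleton.preimage hL)
    rintro _ ⟨ζ, m, hζ, rfl⟩
    exact sphereMoment_isotropic_eq_zero hk hw hρ hρR hF hsol hrad hR hζ m hr
  have htop : (Submodule.span ℂ (isotropicPowers d)).topologicalClosure = ⊤ := by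
    rcases hd with rfl | rfl
    · exact isotropicPowers_dense_two
    · exact isotropicPowers_dense_three
  exact hle (htop ▸ Submodule.mem_top : p ∈ _)

/-- The source of a radiating solution that vanishes on a sphere around its support is orthogonal to
all plane waves `e^{iξ·x}`, `ξ·ξ = k²`, with real or complex `ξ`. -/
lemma integral_source_mul_exp_eq_zero [NeZero d] (hd : d = 2 ∨ d = 3) (hk : 0 < k)
    (hw : Continuous w) (hρ : 0 < ρ) (hρR : ρ < R) (hF : ∀ᵐ x, ρ < ‖x‖ → F x = 0)
    (hsol : SolvesHelmholtz k F w) (hrad : SommerfeldRadiation k w)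
    (hR : ∀ x ∈ sphere (0 : EuclideanSpace ℝ (Fin d)) R, w x = 0) {ξ : Fin d → ℂ}
    (hξ : ∑ i, ξ i ^ 2 = (k : ℂ) ^ 2) :
    ∫ x, F x * Complex.exp (Complex.I * linForm ξ x) = 0 := by
  have hR0 : 0 < R := hρ.trans hρR
  let χ : ContDiffBump (0 : EuclideanSpace ℝ (Fin d)) := ⟨R + 1, R + 2, by linarith, by linarith⟩
  set ψ : EuclideanSpace ℝ (Fin d) → ℂ :=
    fun x => (χ x : ℂ) * Complex.exp (Complex.I * linForm ξ x) with hψ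
  have hψ1 : ∀ x, ‖x‖ < R + 1 → ψ x = Complex.exp (Complex.I * linForm ξ x) := by
    intro x hx
    have : χ x = 1 := χ.one_of_mem_closedBall (by simpa [χ] using hx.le)
    simp [hψ, this]
  have htest : IsTestFunction univ ψ := by
    refine ⟨?_, ?_, subset_univ _⟩
    · exact (Complex.ofRealCLM.contDiff.comp χ.contDiff).mul
        (contDiff_const.mul (contDiff_linForm ξ)).cexp
    · refine HasCompactSupport.intro (isCompact_closedBall 0 (R + 2)) fun x hx => ?_
      have : χ x = 0 := χ.zero_of_le_dist (by
        have := not_le.1 (fun h => hx (mem_closedBall.2 h)); exact this.le)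
      simp [hψ, this]
  have h1 : ∫ x, F x * Complex.exp (Complex.I * linForm ξ x) = ∫ x, F x * ψ x := by
    refine integral_congr_ae ?_
    filter_upwards [hF] with x hx
    rcases lt_or_ge ρ ‖x‖ with h | h
    · simp [hx h]
    · rw [hψ1 x (by linarith)]
  rw [h1, ← hsol ψ htest, integral_eq_integral_polar (htest.integrable_mul_helmholtz hw k)]
  refine setIntegral_eq_zero_of_forall_eq_zero fun r hr => ?_
  have hr0 : 0 < r := hr
  rcases le_or_gt r R with h | h
  · have : ∀ θ : sphere (0 : EuclideanSpace ℝ (Fin d)) 1,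
        Δ ψ (r • (θ : EuclideanSpace ℝ (Fin d))) +
          (k : ℂ) ^ 2 * ψ (r • (θ : EuclideanSpace ℝ (Fin d))) = 0 := by
      intro θ
      have hlt : ‖r • (θ : EuclideanSpace ℝ (Fin d))‖ < R + 1 := by
        simp [norm_smul, abs_of_pos hr0]; linarith
      have hev : ψ =ᶠ[nhds (r • (θ : EuclideanSpace ℝ (Fin d)))]
          fun x => Complex.exp (Complex.I * linForm ξ x) := by
        filter_upwards [isOpen_ball.mem_nhds (mem_ball_zero_iff.2 hlt)] with x hx
        exact hψ1 x (by simpa using hx)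
      rw [(InnerProductSpace.laplacian_congr_nhds hev).eq_of_nhds, laplacian_exp_linForm, hξ,
        hψ1 _ hlt]
      ring
    simp [this]
  · have := sphereMoment_eq_zero hd hk hw hρ hρR hF hsol hrad hR
      ⟨fun θ : sphere (0 : EuclideanSpace ℝ (Fin d)) 1 =>
        Δ ψ (r • (θ : EuclideanSpace ℝ (Fin d))) +
          (k : ℂ) ^ 2 * ψ (r • (θ : EuclideanSpace ℝ (Fin d))), by
        have h2 := htest.continuous_laplacian
        have h3 := htest.contDiff.continuous
        fun_prop⟩ (hρR.trans h)
    simp only [sphereMoment, ContinuousMap.coe_mk] at this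
    rw [this, mul_zero]

end Vanishing

/-! ### Fourier analysis of the source -/

open scoped FourierTransform in
/-- An integrable function whose Fourier transform vanishes almost everywhere is zero. -/
lemma ae_eq_zero_of_fourier_ae_eq_zero {V : Type*} [NormedAddCommGroup V] [InnerProductSpace ℝ V]
    [FiniteDimensional ℝ V] [MeasurableSpace V] [BorelSpace V] {h : V → ℂ} (hh : Integrable h)
    (h0 : ∀ᵐ ξ, 𝓕 h ξ = 0) : h =ᵐ[volume] 0 := by
  refine ae_eq_zero_of_integral_contDiff_smul_eq_zero hh.locallyIntegrable fun g hg hgc => ?_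
  have h1 : HasCompactSupport (fun x => (g x : ℂ)) := hgc.comp_left (g := Complex.ofReal) rfl
  have h2 : ContDiff ℝ ∞ (fun x => (g x : ℂ)) := Complex.ofRealCLM.contDiff.comp hg
  set φ := h1.toSchwartzMap h2 with hφ
  set ψ : SchwartzMap V ℂ := 𝓕⁻ φ
  have hinv : 𝓕 ψ = φ := FourierTransform.fourier_fourierInv_eq φ
  have hflip : ∫ ξ, 𝓕 h ξ • ψ ξ = ∫ x, h x • 𝓕 (ψ : V → ℂ) x := by
    simpa using! VectorFourier.integral_fourierIntegral_smul_eq_flip (L := innerₗ V)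
      (μ := volume) (ν := volume) Real.continuous_fourierChar continuous_inner hh
      (SchwartzMap.integrable ψ)
  have hz : ∫ ξ, 𝓕 h ξ • ψ ξ = 0 := by
    refine integral_eq_zero_of_ae ?_
    filter_upwards [h0] with ξ hξ
    simp [hξ]
  rw [hz] at hflip
  rw [← SchwartzMap.fourier_coe, hinv] at hflip
  rw [hflip]
  refine integral_congr_ae (Eventually.of_forall fun x => ?_)
  simp [hφ, mul_comm]

lemma countable_zeros_of_differentiable {G : ℂ → ℂ} (hG : Differentiable ℂ G) {z₀ : ℂ}
    (h0 : G z₀ ≠ 0) : {z | G z = 0}.Countable := by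
  have hA : AnalyticOnNhd ℂ G univ := fun z _ => hG.analyticAt z
  have h1 := hA.preimage_zero_mem_codiscrete h0
  have h2 : IsDiscrete {z | G z = 0} := by
    have := (mem_codiscrete'.1 h1).2
    have he : (G ⁻¹' {0}ᶜ)ᶜ = {z | G z = 0} := by ext z; simp
    rwa [he] at this
  exact (HereditarilyLindelofSpace.isLindelof _).countable_of_isDiscrete h2

/-- The Fourier–Laplace transform of a compactly supported integrable function is entire. -/
lemma differentiable_integral_mul_exp {g : ℝ → ℂ} {R : ℝ} (hg : Integrable g)
    (hgR : ∀ᵐ t, R ≤ |t| → g t = 0) :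
    Differentiable ℂ fun z : ℂ => ∫ t, g t * Complex.exp (Complex.I * (z * t)) := by
  intro z₀
  have hb : ∀ᵐ t, ∀ z ∈ ball z₀ 1,
      ‖g t * (Complex.I * t * Complex.exp (Complex.I * (z * t)))‖ ≤
        ‖g t‖ * (|R| * Real.exp ((‖z₀‖ + 1) * |R|)) := by
    filter_upwards [hgR] with t ht z hz
    rcases le_or_gt R |t| with h | h
    · simp [ht h]
    · have hz1 : ‖z‖ ≤ ‖z₀‖ + 1 := by
        have h3 := norm_sub_norm_le z z₀
        rw [mem_ball, dist_eq_norm] at hz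
        linarith
      have ht1 : |t| ≤ |R| := h.le.trans (le_abs_self R)
      rw [norm_mul, norm_mul, norm_mul, Complex.norm_I, one_mul, Complex.norm_real,
        Real.norm_eq_abs, Complex.norm_exp]
      gcongr
      refine (Complex.re_le_norm _).trans ?_
      rw [norm_mul, norm_mul, Complex.norm_I, one_mul, Complex.norm_real, Real.norm_eq_abs]
      gcongr
  have hmeas : ∀ z : ℂ, AEStronglyMeasurable (fun t : ℝ =>
      g t * Complex.exp (Complex.I * (z * t))) := fun z =>
    hg.aestronglyMeasurable.mul (by fun_prop : Continuous fun t : ℝ =>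
      Complex.exp (Complex.I * (z * t))).aestronglyMeasurable
  have hint : Integrable (fun t : ℝ => g t * Complex.exp (Complex.I * (z₀ * t))) := by
    refine (hg.norm.mul_const (Real.exp (‖z₀‖ * |R|))).mono' (hmeas z₀) ?_
    filter_upwards [hgR] with t ht
    rcases le_or_gt R |t| with h | h
    · simp [ht h]
    · have ht1 : |t| ≤ |R| := h.le.trans (le_abs_self R)
      rw [norm_mul, Complex.norm_exp]
      gcongr
      refine (Complex.re_le_norm _).trans ?_
      rw [norm_mul, norm_mul, Complex.norm_I, one_mul, Complex.norm_real, Real.norm_eq_abs]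
      gcongr
  refine (hasDerivAt_integral_of_dominated_loc_of_deriv_le (ball_mem_nhds z₀ one_pos)
    (Eventually.of_forall hmeas) hint
    (hg.aestronglyMeasurable.mul (by fun_prop : Continuous fun t : ℝ =>
      Complex.I * t * Complex.exp (Complex.I * (z₀ * t))).aestronglyMeasurable)
    hb (hg.norm.mul_const _) (Eventually.of_forall fun t z _ => ?_)).2.differentiableAt
  have h1 : HasDerivAt (fun z : ℂ => Complex.I * (z * t)) (Complex.I * t) z := by
    simpa using ((hasDerivAt_id z).mul_const (t : ℂ)).const_mul Complex.I
  exact (h1.cexp.const_mul (g t)).congr_deriv (by ring)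

lemma norm_sq_eq_tilde_add {n : ℕ} (x : EuclideanSpace ℝ (Fin (n + 1))) :
    ‖x‖ ^ 2 = ‖tilde x‖ ^ 2 + x (Fin.last n) ^ 2 := by
  simp [EuclideanSpace.real_norm_sq_eq, Fin.sum_univ_castSucc, tilde]

lemma measurePreserving_tilde_last (n : ℕ) :
    MeasurePreserving (fun x : EuclideanSpace ℝ (Fin (n + 1)) => (tilde x, x (Fin.last n)))
      volume (volume.prod volume) := by
  have h1 := PiLp.volume_preserving_ofLp (Fin (n + 1))
  have h2 := volume_preserving_piFinSuccAbove (fun _ : Fin (n + 1) => ℝ) (Fin.last n)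
  have h3 : MeasurePreserving (Prod.swap : ℝ × (Fin n → ℝ) → (Fin n → ℝ) × ℝ)
      (volume.prod volume) (volume.prod volume) := Measure.measurePreserving_swap
  have h4 := (PiLp.volume_preserving_toLp (Fin n)).prod (MeasurePreserving.id (volume : Measure ℝ))
  have h5 := h4.comp (h3.comp (h2.comp h1))
  have heq : (fun x : EuclideanSpace ℝ (Fin (n + 1)) => (tilde x, x (Fin.last n))) =
      Prod.map (WithLp.toLp 2) id ∘ Prod.swap ∘
        MeasurableEquiv.piFinSuccAbove (fun _ => ℝ) (Fin.last n) ∘ WithLp.ofLp := by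
    funext x
    simp only [Function.comp_apply, Prod.map, id, Prod.swap, MeasurableEquiv.piFinSuccAbove_apply,
      Fin.insertNthEquiv_symm_apply]
    congr 1
    ext i
    simp [tilde, Fin.removeNth]
  rw [heq]
  exact h5

lemma integrable_tilde_mul_last {n : ℕ} {f : EuclideanSpace ℝ (Fin n) → ℂ} {g : ℝ → ℂ}
    (hf : Integrable f) (hg : Integrable g) :
    Integrable fun x : EuclideanSpace ℝ (Fin (n + 1)) => f (tilde x) * g (x (Fin.last n)) :=
  (measurePreserving_tilde_last n).integrable_comp_of_integrable (hf.mul_prod hg)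

lemma integral_tilde_mul_last {n : ℕ} {f : EuclideanSpace ℝ (Fin n) → ℂ} {g : ℝ → ℂ}
    (hf : AEStronglyMeasurable f) (hg : AEStronglyMeasurable g) :
    ∫ x : EuclideanSpace ℝ (Fin (n + 1)), f (tilde x) * g (x (Fin.last n)) =
      (∫ y, f y) * ∫ t, g t := by
  have hmp := measurePreserving_tilde_last n
  rw [← integral_prod_mul, ← hmp.map_eq, integral_map hmp.measurable.aemeasurable]
  rw [hmp.map_eq]
  exact (hf.comp_fst).mul (hg.comp_snd)

open scoped FourierTransform in
/-- If `f ⊗ g` is orthogonal to all plane waves of wave number `k`, then `f = 0`. For real `ξ̃` the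
last component `z` of the wave vector is one of the (possibly imaginary) roots of
`z² = k² - |ξ̃|²`, and `f̂(ξ̃) ĝ(z) = 0`. The zeros of the entire function `ĝ` are countable, so
`f̂` vanishes off countably many spheres. -/
lemma ae_eq_zero_of_orthogonal_plane_waves {n : ℕ} [NeZero n] {f : EuclideanSpace ℝ (Fin n) → ℂ}
    {g : ℝ → ℂ} {k : ℂ} {R : ℝ} (hf : Integrable f) (hg : Integrable g)
    (hgR : ∀ᵐ t, R ≤ |t| → g t = 0) (hg0 : ¬ g =ᵐ[volume] 0)
    (h : ∀ ξ : Fin (n + 1) → ℂ, ∑ i, ξ i ^ 2 = k ^ 2 →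
      ∫ x, f (tilde x) * g (x (Fin.last n)) * Complex.exp (Complex.I * linForm ξ x) = 0) :
    f =ᵐ[volume] 0 := by
  set G : ℂ → ℂ := fun z : ℂ => ∫ t, g t * Complex.exp (Complex.I * (z * t)) with hG
  have hGd : Differentiable ℂ G := differentiable_integral_mul_exp hg hgR
  obtain ⟨z₀, hz₀⟩ : ∃ z, G z ≠ 0 := by
    by_contra hc
    push Not at hc
    refine hg0 (ae_eq_zero_of_fourier_ae_eq_zero hg (Eventually.of_forall fun ξ => ?_))
    rw [Real.fourier_eq', ← hc (-2 * Real.pi * ξ)]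
    refine integral_congr_ae (Eventually.of_forall fun t => ?_)
    simp only [smul_eq_mul, RCLike.inner_apply, conj_trivial]
    rw [mul_comm]
    congr 2
    push_cast
    ring
  have hZ := countable_zeros_of_differentiable hGd hz₀
  refine ae_eq_zero_of_fourier_ae_eq_zero hf ?_
  have hnull : volume (⋃ z ∈ {z | G z = 0},
      sphere (0 : EuclideanSpace ℝ (Fin n)) (√((k ^ 2 - z ^ 2) / (2 * Real.pi) ^ 2).re)) = 0 :=
    (measure_biUnion_null_iff hZ).2 fun z _ => Measure.addHaar_sphere _ _ _
  have hae : ∀ᵐ η : EuclideanSpace ℝ (Fin n), η ∉ ⋃ z ∈ {z | G z = 0},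
      sphere (0 : EuclideanSpace ℝ (Fin n)) (√((k ^ 2 - z ^ 2) / (2 * Real.pi) ^ 2).re) :=
    measure_eq_zero_iff_ae_notMem.1 hnull
  filter_upwards [hae] with η hη
  -- The last component of a wave vector over `-2πη`.
  obtain ⟨z, hz⟩ := IsAlgClosed.exists_pow_nat_eq
    (k ^ 2 - ((2 * Real.pi * ‖η‖ : ℝ) : ℂ) ^ 2) two_pos
  have hGz : G z ≠ 0 := by
    intro hGz
    refine hη (mem_biUnion (show z ∈ {z | G z = 0} from hGz) ?_)
    rw [mem_sphere_zero_iff_norm, hz]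
    have hpi : ((2 * Real.pi : ℝ) : ℂ) ≠ 0 := by
      exact_mod_cast (by positivity : (2 * Real.pi : ℝ) ≠ 0)
    have : (k ^ 2 - (k ^ 2 - ((2 * Real.pi * ‖η‖ : ℝ) : ℂ) ^ 2)) / (2 * Real.pi) ^ 2 =
        ((‖η‖ ^ 2 : ℝ) : ℂ) := by
      push_cast at hpi ⊢
      field_simp
      ring
    rw [this, Complex.ofReal_re, Real.sqrt_sq (norm_nonneg η)]
  set ξ : Fin (n + 1) → ℂ := Fin.snoc (α := fun _ => ℂ) (fun i => -2 * Real.pi * (η i : ℂ)) z with hξ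
  have hξ2 : ∑ i, ξ i ^ 2 = k ^ 2 := by
    have hnorm : ∑ i, ((η i : ℂ)) ^ 2 = (‖η‖ : ℂ) ^ 2 := by
      rw [← Complex.ofReal_pow, EuclideanSpace.real_norm_sq_eq]; simp
    simp only [hξ, Fin.sum_univ_castSucc, Fin.snoc_castSucc, Fin.snoc_last, mul_pow,
      ← Finset.mul_sum, hnorm]
    rw [hz]
    push_cast
    ring
  have h1 := h ξ hξ2
  have h2 : ∀ x : EuclideanSpace ℝ (Fin (n + 1)),
      f (tilde x) * g (x (Fin.last n)) * Complex.exp (Complex.I * linForm ξ x) =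
      (fun y => Complex.exp ((-2 * Real.pi * inner ℝ y η : ℝ) * Complex.I) • f y) (tilde x) *
      (fun t : ℝ => g t * Complex.exp (Complex.I * (z * t))) (x (Fin.last n)) := by
    intro x
    have h3 : Complex.I * linForm ξ x = (-2 * Real.pi * inner ℝ (tilde x) η : ℝ) * Complex.I +
        Complex.I * (z * x (Fin.last n)) := by
      simp only [linForm, hξ, Fin.sum_univ_castSucc, Fin.snoc_castSucc, Fin.snoc_last, tilde,
        PiLp.inner_apply, RCLike.inner_apply, conj_trivial, Complex.ofReal_mul, Complex.ofReal_sum]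
      rw [mul_add, Finset.mul_sum, Finset.mul_sum, Finset.sum_mul]
      congr 1
      refine Finset.sum_congr rfl fun i _ => ?_
      push_cast
      ring
    rw [h3, Complex.exp_add]
    simp only [smul_eq_mul]
    ring
  have hm1 : AEStronglyMeasurable fun y : EuclideanSpace ℝ (Fin n) =>
      Complex.exp ((-2 * Real.pi * inner ℝ y η : ℝ) * Complex.I) • f y :=
    AEStronglyMeasurable.smul (by fun_prop : Continuous fun y : EuclideanSpace ℝ (Fin n) =>
      Complex.exp ((-2 * Real.pi * inner ℝ y η : ℝ) * Complex.I)).aestronglyMeasurable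
      hf.aestronglyMeasurable
  have hm2 : AEStronglyMeasurable fun t : ℝ => g t * Complex.exp (Complex.I * (z * t)) :=
    hg.aestronglyMeasurable.mul (by fun_prop : Continuous fun t : ℝ =>
      Complex.exp (Complex.I * (z * t))).aestronglyMeasurable
  rw [integral_congr_ae (Eventually.of_forall h2), integral_tilde_mul_last hm1 hm2] at h1
  rw [Real.fourier_eq']
  exact (mul_eq_zero.1 h1).resolve_right hGz

/-! ### Admissible sources and uniqueness -/

section Admissible

variable {n : ℕ} {R : ℝ} {f : EuclideanSpace ℝ (Fin n) → ℝ → ℂ} {g : ℝ → ℂ}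

/-- The support of an admissible source lies in a ball strictly smaller than `B_R`, and the factors
vanish almost everywhere outside `B̃_R` and `(-R, R)`. -/
lemma IsAdmissible.exists_radius (hR : 0 < R) (h : IsAdmissible R f g) :
    (∃ ρ, 0 < ρ ∧ ρ < R ∧ ∀ k, 0 < k → ∀ᵐ x, ρ < ‖x‖ → source f g k x = 0) ∧
    (∀ k, 0 < k → ∀ᵐ y, y ∉ ball (0 : EuclideanSpace ℝ (Fin n)) R → f y k = 0) ∧
    ∀ᵐ t : ℝ, t ∉ Ioo (-R) R → g t = 0 := by
  obtain ⟨D, H, ⟨y₀, hy₀⟩, ⟨t₀, ht₀⟩, hg, hf, hsub⟩ := h.support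
  obtain ⟨ρ, ⟨hρ0, hρR⟩, hρ⟩ := exists_pos_lt_subset_ball hR isClosed_closure hsub
  have hjoin : ∀ (x : EuclideanSpace ℝ (Fin (n + 1))), tilde x ∈ closure D →
      x (Fin.last n) ∈ closure H → ‖x‖ < ρ := by
    intro x hx1 hx2
    let J : EuclideanSpace ℝ (Fin n) → ℝ → EuclideanSpace ℝ (Fin (n + 1)) :=
      fun y t => WithLp.toLp 2 (Fin.snoc (α := fun _ => ℝ) (fun i => y i) t)
    have hJ : Continuous (Function.uncurry J) := by
      refine (PiLp.continuous_toLp 2 _).comp (continuous_pi fun i => ?_)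
      refine Fin.lastCases ?_ (fun i => ?_) i
      · simpa [Function.uncurry] using continuous_snd
      · simp only [Fin.snoc_castSucc]
        fun_prop
    have hmem := map_mem_closure₂ hJ hx1 hx2
      (u := {x : EuclideanSpace ℝ (Fin (n + 1)) | tilde x ∈ D ∧ x (Fin.last n) ∈ H})
      fun y hy t ht => by
        refine ⟨?_, by simpa [J] using ht⟩
        have : tilde (J y t) = y := by ext i; simp [tilde, J]
        rwa [this]
    have hx : J (tilde x) (x (Fin.last n)) = x := by
      ext i
      refine Fin.lastCases ?_ (fun i => ?_) i <;> simp [tilde, J]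
    rw [hx] at hmem
    simpa using hρ hmem
  refine ⟨⟨ρ, hρ0, hρR, fun k hk => ?_⟩, fun k hk => ?_, ?_⟩
  · have h1 := ((Measure.quasiMeasurePreserving_fst).comp
      (measurePreserving_tilde_last n).quasiMeasurePreserving).ae (hf k hk)
    have h2 := ((Measure.quasiMeasurePreserving_snd).comp
      (measurePreserving_tilde_last n).quasiMeasurePreserving).ae hg
    filter_upwards [h1, h2] with x hx1 hx2 hx
    simp only [Function.comp_apply] at hx1 hx2
    rw [source]
    by_contra hc
    obtain ⟨hc1, hc2⟩ := mul_ne_zero_iff.1 hc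
    exact hx.not_gt (hjoin x (by_contra fun h => hc1 (hx1 h)) (by_contra fun h => hc2 (hx2 h)))
  · filter_upwards [hf k hk] with y hy hyR
    refine hy fun hyD => hyR ?_
    set x : EuclideanSpace ℝ (Fin (n + 1)) :=
      WithLp.toLp 2 (Fin.snoc (α := fun _ => ℝ) (fun i => y i) t₀) with hx
    have h1 : tilde x = y := by ext i; simp [tilde, hx]
    have h2 : x (Fin.last n) = t₀ := by simp [hx]
    have h3 := hjoin x (h1 ▸ hyD) (h2 ▸ subset_closure ht₀)
    have h4 := norm_sq_eq_tilde_add x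
    rw [h1] at h4
    rw [mem_ball_zero_iff]
    nlinarith [norm_nonneg x, norm_nonneg y, sq_nonneg (x (Fin.last n))]
  · filter_upwards [hg] with t ht htR
    refine ht fun htH => htR ?_
    set x : EuclideanSpace ℝ (Fin (n + 1)) :=
      WithLp.toLp 2 (Fin.snoc (α := fun _ => ℝ) (fun i => y₀ i) t) with hx
    have h1 : tilde x = y₀ := by ext i; simp [tilde, hx]
    have h2 : x (Fin.last n) = t := by simp [hx]
    have h3 := hjoin x (h1 ▸ subset_closure hy₀) (h2 ▸ htH)
    have h4 := norm_sq_eq_tilde_add x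
    rw [h2] at h4
    have h5 : t ^ 2 < R ^ 2 := by nlinarith [norm_nonneg x, sq_nonneg ‖tilde x‖]
    exact abs_lt.1 (abs_lt_of_sq_lt_sq h5 hR.le)

lemma IsAdmissible.integrable_left (hR : 0 < R) (h : IsAdmissible R f g) {k : ℝ} (hk : 0 < k) :
    Integrable fun y => f y k := by
  have : IsFiniteMeasure (volume.restrict (ball (0 : EuclideanSpace ℝ (Fin n)) R)) :=
    ⟨by simpa using measure_ball_lt_top⟩
  exact IntegrableOn.integrable_of_ae_notMem_eq_zero
    ((h.memLp_f k hk).integrable (by norm_num)) ((h.exists_radius hR).2.1 k hk)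

lemma IsAdmissible.integrable_right (hR : 0 < R) (h : IsAdmissible R f g) : Integrable g :=
  IntegrableOn.integrable_of_ae_notMem_eq_zero
    (h.memLp_g.integrable (by norm_num)) (h.exists_radius hR).2.2

lemma SolvesHelmholtz.sub {d : ℕ} {k : ℝ} {F₁ F₂ u₁ u₂ : EuclideanSpace ℝ (Fin d) → ℂ}
    (h₁ : SolvesHelmholtz k F₁ u₁) (h₂ : SolvesHelmholtz k F₂ u₂) (hu₁ : Continuous u₁)
    (hu₂ : Continuous u₂) (hF₁ : Integrable F₁) (hF₂ : Integrable F₂) :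
    SolvesHelmholtz k (fun x => F₁ x - F₂ x) (fun x => u₁ x - u₂ x) := by
  intro φ hφ
  obtain ⟨C, hC⟩ := hφ.contDiff.continuous.bounded_above_of_compact_support hφ.hasCompactSupport
  have hint : ∀ {F : EuclideanSpace ℝ (Fin d) → ℂ}, Integrable F →
      Integrable fun x => F x * φ x := fun hF =>
    hF.mul_bdd (c := C) hφ.contDiff.continuous.aestronglyMeasurable (Eventually.of_forall hC)
  simp only [sub_mul]
  rw [integral_sub (hφ.integrable_mul_helmholtz hu₁ k) (hφ.integrable_mul_helmholtz hu₂ k),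
    integral_sub (hint hF₁) (hint hF₂), h₁ φ hφ, h₂ φ hφ]

lemma SommerfeldRadiation.sub {d : ℕ} {k : ℝ} {u₁ u₂ : EuclideanSpace ℝ (Fin d) → ℂ}
    (h₁ : SommerfeldRadiation k u₁) (h₂ : SommerfeldRadiation k u₂) :
    SommerfeldRadiation k fun x => u₁ x - u₂ x := by
  intro ε hε
  obtain ⟨r₁, hr₁, h₁⟩ := h₁ (ε / 2) (half_pos hε)
  obtain ⟨r₂, hr₂, h₂⟩ := h₂ (ε / 2) (half_pos hε)
  refine ⟨max r₁ r₂, lt_max_of_lt_left hr₁, fun x hx => ?_⟩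
  obtain ⟨hd₁, he₁⟩ := h₁ x ((le_max_left _ _).trans hx)
  obtain ⟨hd₂, he₂⟩ := h₂ x ((le_max_right _ _).trans hx)
  refine ⟨hd₁.fun_sub hd₂, ?_⟩
  rw [fderiv_fun_sub hd₁ hd₂]
  have heq : (fderiv ℝ u₁ x - fderiv ℝ u₂ x) (‖x‖⁻¹ • x) -
      Complex.I * (k : ℂ) * (u₁ x - u₂ x) =
      (fderiv ℝ u₁ x (‖x‖⁻¹ • x) - Complex.I * (k : ℂ) * u₁ x) -
      (fderiv ℝ u₂ x (‖x‖⁻¹ • x) - Complex.I * (k : ℂ) * u₂ x) := by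
    rw [sub_apply]; ring
  rw [heq]
  have hpos : 0 ≤ ‖x‖ ^ (((d : ℝ) - 1) / 2) := Real.rpow_nonneg (norm_nonneg x) _
  have := mul_le_mul_of_nonneg_left (norm_sub_le
    (fderiv ℝ u₁ x (‖x‖⁻¹ • x) - Complex.I * (k : ℂ) * u₁ x)
    (fderiv ℝ u₂ x (‖x‖⁻¹ • x) - Complex.I * (k : ℂ) * u₂ x)) hpos
  linarith

/-- Uniqueness at a single wave number: equal Dirichlet data on the sphere force equal sources. -/
lemma source_ae_eq_of_eq_on_sphere {n : ℕ} (hn : n + 1 = 2 ∨ n + 1 = 3) {R k : ℝ} (hR : 0 < R)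
    (hk : 0 < k) {g : ℝ → ℂ} {f₁ f₂ : EuclideanSpace ℝ (Fin n) → ℝ → ℂ}
    (hf₁ : IsAdmissible R f₁ g) (hf₂ : IsAdmissible R f₂ g)
    {u₁ u₂ : EuclideanSpace ℝ (Fin (n + 1)) → ℂ}
    (hu₁ : IsRadiatingSolution R k (source f₁ g k) u₁)
    (hu₂ : IsRadiatingSolution R k (source f₂ g k) u₂)
    (hdata : ∀ x ∈ sphere (0 : EuclideanSpace ℝ (Fin (n + 1))) R, u₁ x = u₂ x) :
    (fun y => f₁ y k) =ᵐ[volume] fun y => f₂ y k := by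
  have : NeZero n := ⟨by rcases hn with h | h <;> omega⟩
  obtain ⟨⟨ρ₁, hρ₁, hρ₁R, hF₁⟩, -, hgR⟩ := hf₁.exists_radius hR
  obtain ⟨⟨ρ₂, hρ₂, hρ₂R, hF₂⟩, -, -⟩ := hf₂.exists_radius hR
  have hi₁ := hf₁.integrable_left hR hk
  have hi₂ := hf₂.integrable_left hR hk
  have hg := hf₁.integrable_right hR
  have hsol := hu₁.helmholtz.sub hu₂.helmholtz hu₁.continuous hu₂.continuous
    (integrable_tilde_mul_last hi₁ hg) (integrable_tilde_mul_last hi₂ hg)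
  have hF : ∀ᵐ x, max ρ₁ ρ₂ < ‖x‖ → source f₁ g k x - source f₂ g k x = 0 := by
    filter_upwards [hF₁ k hk, hF₂ k hk] with x h1 h2 hx
    rw [h1 ((le_max_left _ _).trans_lt hx), h2 ((le_max_right _ _).trans_lt hx), sub_zero]
  have hzero := ae_eq_zero_of_orthogonal_plane_waves (f := fun y => f₁ y k - f₂ y k) (k := k)
    (R := R) (hi₁.sub hi₂) hg (by
      filter_upwards [hgR] with t ht htR
      exact ht fun h => htR.not_gt (abs_lt.2 h))
    (fun h => hf₁.g_ne_zero (ae_restrict_of_ae h)) fun ξ hξ => by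
      have := integral_source_mul_exp_eq_zero hn hk (hu₁.continuous.sub hu₂.continuous)
        (lt_max_of_lt_left hρ₁) (max_lt hρ₁R hρ₂R) hF hsol (hu₁.radiation.sub hu₂.radiation)
        (fun x hx => sub_eq_zero.2 (hdata x hx)) hξ
      simpa only [source, ← sub_mul] using this
  filter_upwards [hzero] with y hy
  exact sub_eq_zero.1 hy

end Admissible

end HelmholtzSource

theorem mainTheorem1 (n : ℕ) (hn : n + 1 = 2 ∨ n + 1 = 3) (R kmin kmax : ℝ) (hR : 0 < R)
    (hkmin : 0 < kmin) (hk : kmin < kmax) (g : ℝ → ℂ)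
    (f₁ f₂ : EuclideanSpace ℝ (Fin n) → ℝ → ℂ)
    (hf₁ : HelmholtzSource.IsAdmissible R f₁ g) (hf₂ : HelmholtzSource.IsAdmissible R f₂ g)
    (u₁ u₂ : EuclideanSpace ℝ (Fin (n + 1)) → ℝ → ℂ)
    (hu₁ : ∀ k : ℝ, 0 < k →
      HelmholtzSource.IsRadiatingSolution R k (HelmholtzSource.source f₁ g k) (fun x => u₁ x k))
    (hu₂ : ∀ k : ℝ, 0 < k →
      HelmholtzSource.IsRadiatingSolution R k (HelmholtzSource.source f₂ g k) (fun x => u₂ x k))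
    (hdata : ∀ k ∈ Set.Icc kmin kmax,
      ∀ x ∈ Metric.sphere (0 : EuclideanSpace ℝ (Fin (n + 1))) R, u₁ x k = u₂ x k) :
    ∀ k : ℝ, 0 < k →
      (fun y => f₁ y k) =ᵐ[MeasureTheory.volume.restrict
        (Metric.ball (0 : EuclideanSpace ℝ (Fin n)) R)] (fun y => f₂ y k) := by
  -- Rational wave numbers keep the exceptional null set independent of `k`.
  have hrat : ∀ᵐ y ∂(volume.restrict (ball (0 : EuclideanSpace ℝ (Fin n)) R)),
      ∀ q : ℚ, (q : ℝ) ∈ Icc kmin kmax → f₁ y q = f₂ y q := by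
    rw [ae_all_iff]
    intro q
    by_cases hq : (q : ℝ) ∈ Icc kmin kmax
    · have hq0 : (0 : ℝ) < q := hkmin.trans_le hq.1
      filter_upwards [ae_restrict_of_ae (HelmholtzSource.source_ae_eq_of_eq_on_sphere hn hR hq0
        hf₁ hf₂ (hu₁ q hq0) (hu₂ q hq0) (hdata q hq))] with y hy _ using hy
    · exact Eventually.of_forall fun y h => absurd h hq
  intro k hk0
  filter_upwards [hrat, hf₁.analytic, hf₂.analytic] with y hy h1 h2
  set c := (kmin + kmax) / 2
  have hc : c ∈ Ioo kmin kmax := ⟨by simp only [c]; linarith, by simp only [c]; linarith⟩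
  refine h1.eqOn_of_preconnected_of_frequently_eq h2 (convex_Ioi 0).isPreconnected
    (mem_Ioi.2 (hkmin.trans hc.1)) ?_ (mem_Ioi.2 hk0)
  have hdense : Dense (range ((↑) : ℚ → ℝ) \ {c}) :=
    (Rat.denseRange_cast (𝕜 := ℝ)).sdiff_singleton c
  have hfreq := mem_closure_iff_frequently.1 (hdense c)
  rw [frequently_nhdsWithin_iff]
  refine (hfreq.and_eventually (isOpen_Ioo.mem_nhds hc)).mono ?_
  rintro _ ⟨⟨⟨q, rfl⟩, hqc⟩, hq⟩
  exact ⟨hy q (Ioo_subset_Icc_self hq), hqc⟩
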